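/- **Theorem (Interpolation in time).** Setting. Let $d\ge 1$, let $\Omega\subset\mathbb{R}^d$ be a bounded open set, and let $J=(0,T)$ with $0<T<\infty$. For open $\omega\subset\Omega$ let $W^{1,2}_0(\omega)$ be the closure of $C_c^\infty(\omega)$ in $W^{1,2}(\omega)$, normed by $\|\nabla\cdot\|_{L^2(\omega)}$, and let $W^{-1,2}(\omega)=W^{1,2}_0(\omega)^*$ be its dual space with the dual norm; a function $u\in L^2(\Omega)$ is identified with the functional $g\mapsto\int_\omega u\,g\,dx$. Let $$V=L^2(J;W^{1,2}_0(\Omega))\cap W^{1,2}(J;W^{-1,2}(\Omega)).$$ Partition in time. Let $\mathcal{T}_t$ be a partition $0=t_0<t_1<\dots<t_N=T$ of $[0,T]$ into closed intervals $[t_{n},t_{n+1}]$. For $K_t\in\mathcal{T}_t$ let $h_{K_t}=|K_t|$ and let $\omega_{K_t}=\bigcup\{K_t'\in\mathcal{T}_t: K_t\cap K_t'\ne\emptyset\}$. Assume that $\mathcal{T}_t$ is shape regular with constant $\kappa$, that is, $|\omega_{K_t}|\le\kappa\,h_{K_t}$ for all $K_t\in\mathcal{T}_t$. The projection. Let $k_t\ge1$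 be an integer. On the reference interval $[0,1]$ let $b_j(x)=\binom{k_t}{j}x^j(1-x)^{k_t-j}$, $0\le j\le k_t$, be the Bernstein polynomials, and let $p_j$, $0\le j\le k_t$, be the (unique) polynomials of the form $$p_j=b_j\Big((k_t+1)+q_j-\sum_{\mu=0}^{k_t}b_\mu q_\mu\Big)$$ with polynomials $q_0,\dots,q_{k_t}$ of degree at most $k_t$ that satisfy $\int_0^1p_i\,b_j\,dx=\delta_{ij}$ for all $0\le i,j\le k_t$. Let $\mathcal{N}_t$ be the set of the $Nk_t+1$ Lagrange nodes of order $k_t$ of $\mathcal{T}_t$. For $i\in\mathcal{N}_t$ let $\omega_i$ be the union of the intervals in $\mathcal{T}_t$ that contain $i$. Let $b_{t,i}$ (respectively $\psi_{t,i}$) be the function that vanishes outside $\omega_i$ and that equals, on each interval of $\omega_i$, the polynomial $b_j$ (respectively $|\omega_i|^{-1}p_j$), transported from $[0,1]$ by the increasing affine map, where $j$ is the number of the node $i$ in this interval (counted from $0$, from left to right). The projection $\Pi_t$ is $$\Pi_tv=\sum_{i\in\mathcal{N}_t}\Big(\int_J v(\sigma)\,\psi_{t,i}(\sigma)\,d\sigma\Big)\,b_{t,i}\qquad\text{for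 }v\in L^2(J;L^2(\Omega)).$$ Claim. There is a constant $C$ that depends only on $k_t$ and $\kappa$ such that the following holds. Let $X=W^{-1,2}(\omega)$ with $\omega\subset\Omega$ open, or $X=L^2(K_x)$ with a simplex $K_x$ of a regular (conforming) partition $\mathcal{T}_x$ of $\overline\Omega$ into finitely many closed simplices. Then for all $v\in V$, all integers $0\le m\le s\le k_t+1$, and all $K_t\in\mathcal{T}_t$, $$\|\partial_t^m(v-\Pi_tv)\|_{L^2(K_t;X)}\le C\,h_{K_t}^{s-m}\,\|\partial_t^sv\|_{L^2(\omega_{K_t};X)} .$$ Here $\partial_t^m$ denotes the weak derivative in the interior of the respective interval, and a norm has the value $\infty$ if the weak derivative does not exist or is not in the respective space; in the case $X=L^2(K_x)$ functions on $\Omega$ are restricted to $K_x\cap\Omega$. -/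

import Mathlib

open MeasureTheory Set
open scoped NNReal ENNReal Polynomial

namespace SpaceTime

/-! ### Reference weights -/

/-- The `L²(0,1)` product of two polynomials on the reference interval. -/
noncomputable def ip (f g : ℝ[X]) : ℝ := ∫ x in (0 : ℝ)..1, f.eval x * g.eval x

/-- The family `p 0, …, p k` of weights on the reference interval: `p j = b j * z j` with
`z j = (k+1) + q j - ∑ μ, b μ * q μ` for some polynomials `q j` of degree at most `k`, where
`b j = bernsteinPolynomial ℝ k j`, and biorthogonal to the Bernstein basis. (The `z j` are uniquely
determined by these conditions.) -/
def IsLocalDual (k : ℕ) (p : ℕ → ℝ[X]) : Prop :=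
  (∃ q : ℕ → ℝ[X], (∀ j ≤ k, (q j).natDegree ≤ k) ∧
    ∀ j ≤ k, p j = bernsteinPolynomial ℝ k j * ((k + 1 : ℝ[X]) + q j
      - ∑ μ ∈ Finset.range (k + 1), bernsteinPolynomial ℝ k μ * q μ)) ∧
  ∀ i ≤ k, ∀ j ≤ k, ip (p i) (bernsteinPolynomial ℝ k j) = if i = j then 1 else 0

lemma ip_intervalIntegrable (f : ℝ[X]) : IntervalIntegrable (fun x => f.eval x) volume (0:ℝ) 1 :=
  f.continuous.intervalIntegrable _ _

lemma ip_eq (f g : ℝ[X]) : ip f g = ∫ x in (0 : ℝ)..1, (f * g).eval x := by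
  simp [ip]

lemma ip_add_left (f g h : ℝ[X]) : ip (f + g) h = ip f h + ip g h := by
  rw [ip_eq, ip_eq, ip_eq, ← intervalIntegral.integral_add (ip_intervalIntegrable _)
    (ip_intervalIntegrable _)]
  simp [add_mul]

lemma ip_smul_left (c : ℝ) (f h : ℝ[X]) : ip (c • f) h = c * ip f h := by
  rw [ip_eq, ip_eq, ← intervalIntegral.integral_const_mul]
  simp

lemma ip_comm (f g : ℝ[X]) : ip f g = ip g f := by
  rw [ip_eq, ip_eq, mul_comm]

/-- `ip` as a bilinear map. -/
noncomputable def ipL : ℝ[X] →ₗ[ℝ] ℝ[X] →ₗ[ℝ] ℝ :=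
  LinearMap.mk₂ ℝ ip ip_add_left (fun c f h => by simpa using ip_smul_left c f h)
    (fun f g h => by rw [ip_comm, ip_add_left, ip_comm g, ip_comm h])
    (fun c f h => by rw [ip_comm, ip_smul_left, ip_comm h]; rfl)

lemma ipL_apply (f g : ℝ[X]) : ipL f g = ip f g := rfl

lemma bernstein_integral (k : ℕ) (j : ℕ) (hj : j ≤ k) :
    ip (bernsteinPolynomial ℝ k j) 1 = 1 / (k + 1) := by
  have step : ∀ ν, ν < k → ip (bernsteinPolynomial ℝ k ν) 1
      = ip (bernsteinPolynomial ℝ k (ν + 1)) 1 := by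
    intro ν hν
    have h := intervalIntegral.integral_eq_sub_of_hasDerivAt (a := (0:ℝ)) (b := 1)
      (f := fun x => (bernsteinPolynomial ℝ (k + 1) (ν + 1)).eval x)
      (fun x _ => (bernsteinPolynomial ℝ (k + 1) (ν + 1)).hasDerivAt x)
      (ip_intervalIntegrable _)
    rw [bernsteinPolynomial.eval_at_0, bernsteinPolynomial.eval_at_1,
      bernsteinPolynomial.derivative_succ, if_neg (by omega), if_neg (by omega)] at h
    have h2 : ip (((k + 1 : ℕ) : ℝ) • (bernsteinPolynomial ℝ k ν
        + (-1 : ℝ) • bernsteinPolynomial ℝ k (ν + 1))) 1 = 0 := by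
      rw [ip_eq]
      refine Eq.trans ?_ (h.trans (sub_zero 0))
      congr 1
      ext x
      simp [Polynomial.smul_eq_C_mul]
      ring
    rw [ip_smul_left, ip_add_left, ip_smul_left] at h2
    have : ((k + 1 : ℕ) : ℝ) ≠ 0 := by positivity
    have := (mul_eq_zero.1 h2).resolve_left this
    linarith
  have all : ∀ ν ≤ k, ip (bernsteinPolynomial ℝ k ν) 1 = ip (bernsteinPolynomial ℝ k 0) 1 := by
    intro ν
    induction ν with
    | zero => intro _; rfl
    | succ n ih => intro h; rw [← step n (by omega), ih (by omega)]
  have hs : ∑ ν ∈ Finset.range (k + 1), ip (bernsteinPolynomial ℝ k ν) 1 = 1 := by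
    have : ∑ ν ∈ Finset.range (k + 1), ipL.flip 1 (bernsteinPolynomial ℝ k ν) = 1 := by
      rw [← map_sum, bernsteinPolynomial.sum]
      simp [ipL_apply, ip]
    exact this
  rw [Finset.sum_congr rfl (fun ν hν => all ν (by simpa [Nat.lt_succ_iff] using hν))] at hs
  rw [all j hj]
  simp at hs
  field_simp
  linarith

lemma bernstein_indep (k : ℕ) (c : Fin (k + 1) → ℝ)
    (h : ∑ j : Fin (k + 1), c j • bernsteinPolynomial ℝ k j = 0) : c = 0 := by
  let P : ℝ[X] := ∑ j : Fin (k + 1), Polynomial.C (c j * (k.choose j : ℝ)) * Polynomial.X ^ (j : ℕ)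
  have hP : P = 0 := by
    refine Polynomial.eq_zero_of_infinite_isRoot P (Set.Infinite.mono ?_ (Set.Ioi_infinite (0:ℝ)))
    intro y hy
    have hy : 0 < y := hy
    have hy1 : (1 + y) ≠ 0 := by positivity
    have h1 := congrArg (Polynomial.eval (y / (1 + y))) h
    simp only [Polynomial.eval_finsetSum, Polynomial.eval_smul, bernsteinPolynomial,
      Polynomial.eval_mul, Polynomial.eval_pow, Polynomial.eval_X, Polynomial.eval_natCast,
      Polynomial.eval_sub, Polynomial.eval_one, smul_eq_mul, Polynomial.eval_zero] at h1
    have h2 : P.eval y = (1 + y) ^ k * 0 := by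
      rw [← h1, Finset.mul_sum]
      simp only [P, Polynomial.eval_finsetSum, Polynomial.eval_mul, Polynomial.eval_pow,
        Polynomial.eval_X, Polynomial.eval_C]
      refine Finset.sum_congr rfl fun j _ => ?_
      have e : 1 - y / (1 + y) = 1 / (1 + y) := by field_simp; ring
      have e2 : (1 + y) ^ k = (1 + y) ^ (j : ℕ) * (1 + y) ^ (k - j) := by
        rw [← pow_add]; congr 1; omega
      rw [e, e2, div_pow, div_pow]
      field_simp
      simp
    simpa [Polynomial.IsRoot] using h2
  ext j
  have h3 := congrArg (fun p => Polynomial.coeff p (j : ℕ)) hP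
  simp only [P, Polynomial.finsetSum_coeff, Polynomial.coeff_C_mul, Polynomial.coeff_X_pow,
    Polynomial.coeff_zero] at h3
  rw [Finset.sum_eq_single j (fun b _ hb => by
    rw [if_neg (fun h => hb (Fin.ext h.symm))]; simp) (by simp)] at h3
  have : (k.choose j : ℝ) ≠ 0 := by
    exact_mod_cast (Nat.choose_pos (by omega)).ne'
  simpa [this] using h3

set_option maxHeartbeats 800000 in
lemma exists_localDual (k : ℕ) : ∃ p, IsLocalDual k p := by
  let b : Fin (k + 1) → ℝ[X] := fun j => bernsteinPolynomial ℝ k j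
  have hb1 : ∑ j, b j = 1 := by
    rw [← bernsteinPolynomial.sum ℝ k, Finset.sum_range]
  let Q : Fin (k + 1) → (Fin (k + 1) → Fin (k + 1) → ℝ) →ₗ[ℝ] ℝ[X] := fun a =>
    ∑ c, ((LinearMap.proj c : (Fin (k + 1) → ℝ) →ₗ[ℝ] ℝ) ∘ₗ LinearMap.proj a).smulRight (b c)
  have hQ : ∀ a ρ, Q a ρ = ∑ c, ρ a c • b c := by intro a ρ; simp [Q]
  let D : Fin (k + 1) → (Fin (k + 1) → Fin (k + 1) → ℝ) →ₗ[ℝ] ℝ[X] := fun a =>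
    Q a - ∑ μ, LinearMap.mulLeft ℝ (b μ) ∘ₗ Q μ
  have hD : ∀ a ρ, D a ρ = Q a ρ - ∑ μ, b μ * Q μ ρ := by intro a ρ; simp [D]
  have hD0 : ∀ ρ, ∑ a, b a * D a ρ = 0 := by
    intro ρ
    simp only [hD, mul_sub, Finset.sum_sub_distrib]
    rw [← Finset.sum_mul, hb1, one_mul, sub_self]
  let B : (Fin (k + 1) → Fin (k + 1) → ℝ) →ₗ[ℝ] (Fin (k + 1) → Fin (k + 1) → ℝ) →ₗ[ℝ] ℝ :=
    ∑ a, ipL.compl₁₂ (LinearMap.mulLeft ℝ (b a) ∘ₗ D a) (Q a)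
  have hB : ∀ ρ σ, B ρ σ = ∑ a, ip (b a * D a ρ) (Q a σ) := by
    intro ρ σ; simp [B, ipL_apply]
  clear_value B D Q
  have hBD : ∀ ρ σ, B ρ σ = ∑ a, ip (b a * D a ρ) (D a σ) := by
    intro ρ σ
    rw [hB]
    simp only [hD _ σ, ← ipL_apply, map_sub, Finset.sum_sub_distrib]
    rw [← LinearMap.sum_apply, ← map_sum, hD0]
    simp
  have hsymm : ∀ ρ σ, B ρ σ = B σ ρ := by
    intro ρ σ
    rw [hBD, hBD]
    refine Finset.sum_congr rfl fun a _ => ?_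
    rw [ip_eq, ip_eq, mul_right_comm]
  -- the kernel consists of the constant families
  have hker : ∀ ρ, B ρ = 0 → ∀ a a', ρ a = ρ a' := by
    intro ρ hρ
    have h0 : ∑ a, ip (b a * D a ρ) (D a ρ) = 0 := by rw [← hBD, hρ]; rfl
    have bpos : ∀ a, ∀ x ∈ Ioo (0:ℝ) 1, 0 < (b a).eval x := by
      intro a x hx
      simp only [b, bernsteinPolynomial, Polynomial.eval_mul, Polynomial.eval_pow,
        Polynomial.eval_X, Polynomial.eval_natCast, Polynomial.eval_sub, Polynomial.eval_one]
      have h1 : 0 < 1 - x := by linarith [hx.2]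
      have h2 : (0:ℝ) < (k.choose a : ℝ) := by
        exact_mod_cast Nat.choose_pos (by omega)
      have h3 := hx.1
      positivity
    have nn : ∀ a, ∀ x ∈ Ioo (0:ℝ) 1, 0 ≤ (b a * D a ρ * D a ρ).eval x := by
      intro a x hx
      simp only [Polynomial.eval_mul]
      have := (bpos a x hx).le
      rw [mul_assoc]
      exact mul_nonneg this (mul_self_nonneg _)
    have ipnn : ∀ a, 0 ≤ ip (b a * D a ρ) (D a ρ) := by
      intro a
      rw [ip_eq, intervalIntegral.integral_of_le zero_le_one, integral_Ioc_eq_integral_Ioo]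
      exact setIntegral_nonneg measurableSet_Ioo (nn a)
    have hD' : ∀ a, D a ρ = 0 := by
      intro a
      have h1 := (Finset.sum_eq_zero_iff_of_nonneg (fun a _ => ipnn a)).1 h0 a (Finset.mem_univ a)
      by_contra hne
      have hroot : ((D a ρ).rootSet ℝ).Finite := Polynomial.rootSet_finite _ _
      have hinf : (Ioo (0:ℝ) 1).Infinite := Set.Ioo_infinite zero_lt_one
      obtain ⟨x, hx, hxr⟩ := (hinf.sdiff hroot).nonempty
      have hx0 : (D a ρ).eval x ≠ 0 := by
        intro h; apply hxr; rw [Polynomial.mem_rootSet]; exact ⟨hne, by simpa using h⟩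
      have hpos : 0 < ip (b a * D a ρ) (D a ρ) := by
        rw [ip_eq]
        refine intervalIntegral.integral_pos zero_lt_one (Polynomial.continuous _).continuousOn
          ?_ ⟨x, ⟨hx.1.le, hx.2.le⟩, ?_⟩
        · intro y hy
          rcases eq_or_lt_of_le hy.2 with rfl | hy2
          · simp only [Polynomial.eval_mul, mul_assoc]
            refine mul_nonneg ?_ (mul_self_nonneg _)
            simp only [b, bernsteinPolynomial.eval_at_1]; split_ifs <;> norm_num
          · exact nn a y ⟨hy.1, hy2⟩
        · simp only [Polynomial.eval_mul, mul_assoc]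
          exact mul_pos (bpos a x hx) (mul_self_pos.2 hx0)
      exact hpos.ne' h1
    intro a a'
    have : Q a ρ = Q a' ρ := by
      have h1 := hD' a; have h2 := hD' a'
      rw [hD] at h1 h2
      exact (sub_eq_zero.1 h1).trans (sub_eq_zero.1 h2).symm
    rw [hQ, hQ, ← sub_eq_zero, ← Finset.sum_sub_distrib] at this
    have := bernstein_indep k (ρ a - ρ a') (by simpa [sub_smul] using this)
    exact sub_eq_zero.1 this
  let ℓ : (Fin (k + 1) → Fin (k + 1) → ℝ) →ₗ[ℝ] ℝ :=
    ∑ a, ((LinearMap.proj a : (Fin (k + 1) → ℝ) →ₗ[ℝ] ℝ) ∘ₗ LinearMap.proj a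
      - ((k : ℝ) + 1) • (ipL (b a) ∘ₗ Q a))
  have hℓ : ∀ σ, ℓ σ = ∑ a, (σ a a - (k + 1) * ip (b a) (Q a σ)) := by
    intro σ; simp [ℓ, ipL_apply]
  clear_value ℓ
  have hmem : ℓ ∈ LinearMap.range B.dualMap := by
    rw [LinearMap.range_dualMap_eq_dualAnnihilator_ker, Submodule.mem_dualAnnihilator]
    intro σ hσ
    have hc := hker σ (LinearMap.mem_ker.1 hσ)
    have hQc : ∀ a, Q a σ = Q 0 σ := fun a => by rw [hQ, hQ, hc a 0]
    rw [hℓ, Finset.sum_sub_distrib, ← Finset.mul_sum]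
    simp only [hQc, hc _ 0]
    have h1 : ∑ a, ip (b a) (Q 0 σ) = ip (Q 0 σ) 1 := by
      simp only [← ipL_apply]
      rw [← LinearMap.sum_apply, ← map_sum, hb1, ipL_apply, ip_comm, ipL_apply]
    have h2 : ip (Q 0 σ) 1 = ∑ c, σ 0 c * (1 / (k + 1)) := by
      rw [hQ, ← ipL_apply, map_sum, LinearMap.sum_apply]
      refine Finset.sum_congr rfl fun c _ => ?_
      rw [ipL_apply, ip_smul_left, bernstein_integral k c (by omega)]
    rw [h1, h2, ← Finset.sum_mul]
    field_simp
    simp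
  obtain ⟨F, hF⟩ := hmem
  obtain ⟨ρ, rfl⟩ := (Module.evalEquiv ℝ (Fin (k + 1) → Fin (k + 1) → ℝ)).surjective F
  have hρ : ∀ σ, B ρ σ = ℓ σ := by
    intro σ
    rw [← hF, hsymm]; rfl
  have key : ∀ a c, ip (b a * D a ρ) (b c) = (if a = c then 1 else 0) - (k + 1) * ip (b a) (b c) := by
    intro a c
    have h := hρ (Pi.single a (Pi.single c 1))
    have hQs : ∀ a', Q a' (Pi.single a (Pi.single c 1)) = if a' = a then b c else 0 := by
      intro a'
      rw [hQ]
      split_ifs with h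
      · subst h; simp [Pi.single_apply]
      · simp [h]
    have ip0 : ∀ f, ip f 0 = 0 := fun f => by simp [ip]
    rw [hB, hℓ, Finset.sum_sub_distrib, ← Finset.mul_sum] at h
    simp only [hQs, apply_ite (ip _), ip0, Finset.sum_ite_eq', Finset.mem_univ, if_true] at h
    rw [h]
    congr 1
    rw [Finset.sum_eq_single a (fun a' _ h' => by simp [h']) (by simp)]
    simp [Pi.single_apply]
  let q : ℕ → ℝ[X] := fun j => if h : j < k + 1 then Q ⟨j, h⟩ ρ else 0
  have hqsum : ∑ μ ∈ Finset.range (k + 1), bernsteinPolynomial ℝ k μ * q μ = ∑ μ, b μ * Q μ ρ := by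
    rw [Finset.sum_range]
    refine Finset.sum_congr rfl fun μ _ => ?_
    simp only [q, b, dif_pos μ.2]
  refine ⟨fun j => bernsteinPolynomial ℝ k j * ((k + 1 : ℝ[X]) + q j
      - ∑ μ ∈ Finset.range (k + 1), bernsteinPolynomial ℝ k μ * q μ), ⟨q, ?_, fun _ _ => rfl⟩, ?_⟩
  · intro j hj
    simp only [q, dif_pos (Nat.lt_succ_of_le hj), hQ]
    refine Polynomial.natDegree_sum_le_of_forall_le _ _ fun c _ => ?_
    refine (Polynomial.natDegree_smul_le _ _).trans ?_
    simp only [b, bernsteinPolynomial]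
    have hc : (c : ℕ) ≤ k := by omega
    calc _ ≤ 0 + (c : ℕ) + (k - c) := by
          refine Polynomial.natDegree_mul_le_of_le (Polynomial.natDegree_mul_le_of_le
            (by simp) (by simp)) ?_
          refine (Polynomial.natDegree_pow_le_of_le (m := 1) _ ?_).trans (by simp)
          exact (Polynomial.natDegree_sub_le _ _).trans (by simp)
      _ ≤ k := by omega
  · intro i hi j hj
    have h := key ⟨i, Nat.lt_succ_of_le hi⟩ ⟨j, Nat.lt_succ_of_le hj⟩
    rw [hD] at h
    simp only [hqsum, q, dif_pos (Nat.lt_succ_of_le hi)]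
    have e : bernsteinPolynomial ℝ k i * ((k + 1 : ℝ[X]) + Q ⟨i, Nat.lt_succ_of_le hi⟩ ρ
        - ∑ μ, b μ * Q μ ρ) = ((k : ℝ) + 1) • bernsteinPolynomial ℝ k i
        + bernsteinPolynomial ℝ k i * (Q ⟨i, Nat.lt_succ_of_le hi⟩ ρ - ∑ μ, b μ * Q μ ρ) := by
      rw [Polynomial.smul_eq_C_mul]
      simp
      ring
    rw [e, ip_add_left, ip_smul_left]
    simp only [b, Fin.mk.injEq] at h
    simp only [b]
    rw [h]
    ring

/-! ### Function spaces in space -/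

/-- `ℝ^d` with the Euclidean norm. -/
abbrev Euc (d : ℕ) := EuclideanSpace ℝ (Fin d)

/-- `L²(Ω)` for a subset `Ω` of `ℝ^d`. -/
noncomputable abbrev L2 {d : ℕ} (Ω : Set (Euc d)) := Lp ℝ 2 (volume.restrict Ω)

/-- Restriction `L²(Ω) → L²(S)` for `S ⊆ Ω`. -/
noncomputable def restrictL2 {d : ℕ} {S Ω : Set (Euc d)} (h : S ⊆ Ω) (u : L2 Ω) : L2 S :=
  ((Lp.memLp u).mono_measure (Measure.restrict_mono h le_rfl)).toLp u

/-- The pairs `(φ, ∇φ)`, as elements of `L²(ω) × L²(ω; ℝ^d)`, of test functions `φ ∈ C_c^∞(ω)`. -/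
noncomputable def testGraph {d : ℕ} (ω : Set (Euc d)) :
    Submodule ℝ (L2 ω × Lp (Euc d) 2 (volume.restrict ω)) where
  carrier := {p | ∃ φ : Euc d → ℝ, ContDiff ℝ (⊤ : ℕ∞) φ ∧ HasCompactSupport φ ∧ tsupport φ ⊆ ω ∧
    p.1 =ᵐ[volume.restrict ω] φ ∧ p.2 =ᵐ[volume.restrict ω] gradient φ}
  zero_mem' := by
    refine ⟨0, contDiff_const, HasCompactSupport.zero, by simp [tsupport], Lp.coeFn_zero _ _ _, ?_⟩
    filter_upwards [Lp.coeFn_zero (Euc d) 2 (volume.restrict ω)] with x hx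
    simp only [Prod.snd_zero, hx, Pi.zero_apply]
    exact (gradient_const x 0).symm
  add_mem' := by
    rintro p q ⟨φ, h1, h2, h3, h4, h5⟩ ⟨χ, k1, k2, k3, k4, k5⟩
    refine ⟨φ + χ, h1.add k1, h2.add k2,
      (tsupport_add _ _).trans (union_subset h3 k3), ?_, ?_⟩
    · exact (Lp.coeFn_add _ _).trans (h4.add k4)
    · refine (Lp.coeFn_add _ _).trans ((h5.add k5).trans (Filter.Eventually.of_forall fun x => ?_))
      have hφ : DifferentiableAt ℝ φ x := (h1.differentiable (by simp)) x
      have hχ : DifferentiableAt ℝ χ x := (k1.differentiable (by simp)) x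
      simp [gradient, fderiv_add hφ hχ]
  smul_mem' := by
    rintro c p ⟨φ, h1, h2, h3, h4, h5⟩
    refine ⟨c • φ, h1.const_smul c, h2.smul_left (f := fun _ => c), 
      (closure_mono (Function.support_const_smul_subset c φ)).trans h3, ?_, ?_⟩
    · exact (Lp.coeFn_smul _ _).trans (h4.const_smul c)
    · refine (Lp.coeFn_smul _ _).trans ((h5.const_smul c).trans
        (Filter.Eventually.of_forall fun x => ?_))
      have hφ : DifferentiableAt ℝ φ x := (h1.differentiable (by simp)) x
      simp [gradient, fderiv_const_smul hφ]

/-- The Sobolev space `W_0^{1,2}(ω)`: the closure of the test functions with respect to the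
`W^{1,2}` norm; an element is represented by the pair `(u, ∇u)`. -/
def W01 {d : ℕ} (ω : Set (Euc d)) : Type := ↥(testGraph ω).topologicalClosure

namespace W01

variable {d : ℕ} {ω : Set (Euc d)}

noncomputable instance : AddCommGroup (W01 ω) :=
  inferInstanceAs (AddCommGroup ↥(testGraph ω).topologicalClosure)

noncomputable instance : Module ℝ (W01 ω) :=
  inferInstanceAs (Module ℝ ↥(testGraph ω).topologicalClosure)

/-- The underlying `L²` function. -/
noncomputable def toL2 : W01 ω →ₗ[ℝ] L2 ω :=
  LinearMap.fst ℝ _ _ ∘ₗ (testGraph ω).topologicalClosure.subtype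

/-- The weak gradient. -/
noncomputable def grad : W01 ω →ₗ[ℝ] Lp (Euc d) 2 (volume.restrict ω) :=
  LinearMap.snd ℝ _ _ ∘ₗ (testGraph ω).topologicalClosure.subtype

/-- `W_0^{1,2}(ω)` carries the norm `‖∇u‖_{L²(ω)}`. -/
noncomputable instance : SeminormedAddCommGroup (W01 ω) :=
  SeminormedAddCommGroup.induced (W01 ω) (Lp (Euc d) 2 (volume.restrict ω)) grad

noncomputable instance : NormedSpace ℝ (W01 ω) :=
  NormedSpace.induced ℝ (W01 ω) (Lp (Euc d) 2 (volume.restrict ω)) grad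

lemma norm_def (u : W01 ω) : ‖u‖ = ‖grad u‖ := rfl

end W01

/-- Friedrichs' inequality for test functions. -/
lemma friedrichs_test {d : ℕ} [NeZero d] {ω : Set (Euc d)} {R : ℝ} (hR : ∀ x ∈ ω, ‖x‖ ≤ R)
    (p : L2 ω × Lp (Euc d) 2 (volume.restrict ω)) (hp : p ∈ testGraph ω) :
    ‖p.1‖ ≤ 2 * R * ‖p.2‖ := by
  obtain ⟨φ, h1, h2, h3, h4, h5⟩ := hp
  rcases eq_or_ne ‖p.1‖ 0 with h0 | h0
  · rw [h0]
    rcases ω.eq_empty_or_nonempty with rfl | ⟨x, hx⟩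
    · have : ‖p.2‖ = 0 := by
        rw [Lp.norm_def]; simp
      rw [this]; simp
    · have := (norm_nonneg x).trans (hR x hx)
      positivity
  have hne : ω.Nonempty := by
    by_contra h
    rw [not_nonempty_iff_eq_empty] at h
    subst h
    apply h0
    rw [Lp.norm_def]; simp
  have hR0 : 0 ≤ R := by
    obtain ⟨x, hx⟩ := hne
    exact (norm_nonneg x).trans (hR x hx)
  let e : Euc d := EuclideanSpace.single 0 1
  let g : Euc d → ℝ := fun x => x 0
  have hg : ∀ x, HasFDerivAt g (EuclideanSpace.proj 0 : Euc d →L[ℝ] ℝ) x := fun x =>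
    (EuclideanSpace.proj (0 : Fin d) : Euc d →L[ℝ] ℝ).hasFDerivAt
  have hgc : Continuous g := (EuclideanSpace.proj (0 : Fin d) : Euc d →L[ℝ] ℝ).continuous
  have hge : ∀ x, fderiv ℝ g x e = 1 := fun x => by rw [(hg x).fderiv]; simp [e]
  have hφd : Differentiable ℝ φ := h1.differentiable (by simp)
  have hφ2 : ∀ x, fderiv ℝ (fun x => φ x * φ x) x e = 2 * φ x * fderiv ℝ φ x e := by
    intro x
    rw [fderiv_fun_mul (hφd x) (hφd x)]
    simp; ring
  have hdc : Continuous fun x => fderiv ℝ φ x e :=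
    (h1.continuous_fderiv (by simp)).clm_apply continuous_const
  have hφc : Continuous φ := h1.continuous
  have cs : ∀ f : Euc d → ℝ, Continuous f → Integrable (fun x => φ x * f x) volume := fun f hf =>
    (hφc.mul hf).integrable_of_hasCompactSupport h2.mul_right
  have ibp := integral_mul_fderiv_eq_neg_fderiv_mul_of_integrable (μ := (volume : Measure (Euc d)))
    (f := fun x => φ x * φ x) (g := g) (v := e)
    (by
      simp only [hφ2]
      refine (cs (fun x => 2 * fderiv ℝ φ x e * g x)
        ((continuous_const.mul hdc).mul hgc)).congr (Filter.Eventually.of_forall fun x => ?_)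
      simp only; ring)
    (by simpa [hge] using cs φ hφc)
    (by simpa [mul_assoc] using cs (fun x => φ x * g x) (hφc.mul hgc))
    (fun x _ => ((hφd x).mul (hφd x)))
    (fun x _ => (hg x).differentiableAt)
  simp only [hge, mul_one, hφ2] at ibp
  have supp : ∀ x ∉ ω, φ x = 0 := fun x hx => by
    by_contra h
    exact hx (h3 (subset_tsupport _ h))
  have hsq : ‖p.1‖ * ‖p.1‖ = ∫ x, φ x * φ x := by
    rw [← real_inner_self_eq_norm_mul_norm, L2.inner_def]
    rw [← setIntegral_eq_integral_of_forall_compl_eq_zero (s := ω) (f := fun x => φ x * φ x)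
      (fun x hx => by simp [supp x hx])]
    refine integral_congr_ae ?_
    filter_upwards [h4] with x hx
    simp [hx, pow_two]
  have hgrad : ∀ x, |fderiv ℝ φ x e| ≤ ‖gradient φ x‖ := by
    intro x
    have := (fderiv ℝ φ x).le_opNorm e
    simpa [gradient, e] using this
  have hmem1 : MemLp (fun x => ‖p.1 x‖) (ENNReal.ofReal 2) (volume.restrict ω) := by
    simpa using (Lp.memLp p.1).norm
  have hmem2 : MemLp (fun x => ‖p.2 x‖) (ENNReal.ofReal 2) (volume.restrict ω) := by
    simpa using (Lp.memLp p.2).norm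
  have hCS := integral_mul_le_Lp_mul_Lq_of_nonneg (μ := volume.restrict ω)
    Real.HolderConjugate.two_two
    (Filter.Eventually.of_forall fun x => norm_nonneg (p.1 x))
    (Filter.Eventually.of_forall fun x => norm_nonneg (p.2 x)) hmem1 hmem2
  have hint : Integrable (fun x => ‖p.1 x‖ * ‖p.2 x‖) (volume.restrict ω) :=
    MemLp.integrable_mul (p := 2) (q := 2) (Lp.memLp p.1).norm (Lp.memLp p.2).norm
  have n1 : (∫ x in ω, ‖p.1 x‖ ^ (2:ℝ)) ^ (1 / (2:ℝ)) = ‖p.1‖ := by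
    rw [Lp.norm_def, (Lp.memLp p.1).eLpNorm_eq_integral_rpow_norm (by simp) (by simp),
      ENNReal.toReal_ofReal (by positivity)]
    simp
  have n2 : (∫ x in ω, ‖p.2 x‖ ^ (2:ℝ)) ^ (1 / (2:ℝ)) = ‖p.2‖ := by
    rw [Lp.norm_def, (Lp.memLp p.2).eLpNorm_eq_integral_rpow_norm (by simp) (by simp),
      ENNReal.toReal_ofReal (by positivity)]
    simp
  rw [n1, n2] at hCS
  have hmain : ‖p.1‖ * ‖p.1‖ ≤ 2 * R * (‖p.1‖ * ‖p.2‖) := by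
    rw [hsq, ibp]
    refine (neg_le_abs _).trans ((abs_integral_le_integral_abs).trans ?_)
    rw [← setIntegral_eq_integral_of_forall_compl_eq_zero (s := ω)
      (fun x hx => by simp [supp x hx])]
    calc ∫ x in ω, |2 * φ x * fderiv ℝ φ x e * g x|
        ≤ ∫ x in ω, 2 * R * (‖p.1 x‖ * ‖p.2 x‖) := by
          refine integral_mono_of_nonneg (Filter.Eventually.of_forall fun x => abs_nonneg _)
            (hint.const_mul _) ?_
          filter_upwards [h4, h5] with x hx1 hx2
          by_cases hx : x ∈ ω
          · simp only [hx1, hx2, abs_mul]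
            have a1 : |g x| ≤ R := (by
              simpa [g] using (PiLp.norm_apply_le x 0).trans (hR x hx))
            have a2 := hgrad x
            calc |(2:ℝ)| * |φ x| * |fderiv ℝ φ x e| * |g x|
                ≤ 2 * |φ x| * ‖gradient φ x‖ * R := by
                  rw [abs_two]; gcongr
              _ = 2 * R * (‖φ x‖ * ‖gradient φ x‖) := by rw [Real.norm_eq_abs]; ring
          · simp only [supp x hx]
            simp only [mul_zero, zero_mul, abs_zero]
            positivity
      _ = 2 * R * ∫ x in ω, ‖p.1 x‖ * ‖p.2 x‖ := integral_const_mul _ _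
      _ ≤ _ := by gcongr
  have hpos : 0 < ‖p.1‖ := lt_of_le_of_ne (norm_nonneg _) (Ne.symm h0)
  have : ‖p.1‖ * ‖p.1‖ ≤ ‖p.1‖ * (2 * R * ‖p.2‖) := by linarith
  exact le_of_mul_le_mul_left this hpos

/-- Friedrichs' inequality: `W_0^{1,2}(ω)` embeds into `L²(ω)` if `ω` is bounded. -/
lemma friedrichs {d : ℕ} [NeZero d] {ω : Set (Euc d)} (hω : Bornology.IsBounded ω) :
    ∃ C : ℝ, ∀ u : W01 ω, ‖W01.toL2 u‖ ≤ C * ‖u‖ := by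
  obtain ⟨R, hR⟩ := hω.exists_norm_le
  refine ⟨2 * R, fun u => ?_⟩
  have hcl : IsClosed {p : L2 ω × Lp (Euc d) 2 (volume.restrict ω) | ‖p.1‖ ≤ 2 * R * ‖p.2‖} :=
    isClosed_le (by fun_prop) (by fun_prop)
  exact closure_minimal (friedrichs_test hR) hcl (Subtype.property u)

/-- The embedding `W_0^{1,2}(ω) → L²(ω)` for bounded `ω`. -/
noncomputable def W01.toL2CLM {d : ℕ} [NeZero d] {ω : Set (Euc d)} (hω : Bornology.IsBounded ω) :
    W01 ω →L[ℝ] L2 ω :=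
  W01.toL2.mkContinuousOfExistsBound (friedrichs hω)

/-- The dual space `W^{-1,2}(ω) = W_0^{1,2}(ω)^*` with the operator norm, that is,
`‖ξ‖ = sup {⟨ξ, g⟩ : ‖∇g‖_{L²(ω)} ≤ 1}`. -/
abbrev Wneg {d : ℕ} (ω : Set (Euc d)) := StrongDual ℝ (W01 ω)

noncomputable instance {d : ℕ} {ω : Set (Euc d)} : NormedAddCommGroup (Wneg ω) :=
  NormedAddCommGroup.ofSeparation fun f hf => by
    ext u
    have h := f.le_opNorm u
    rw [hf, zero_mul] at h
    exact norm_le_zero_iff.1 h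

/-- `u ∈ L²(Ω)` as an element of `W^{-1,2}(ω)`, `ω ⊆ Ω`: the functional `g ↦ ∫_ω u g`. -/
noncomputable def toWneg {d : ℕ} [NeZero d] {ω Ω : Set (Euc d)} (hω : Bornology.IsBounded ω)
    (h : ω ⊆ Ω) (u : L2 Ω) : Wneg ω :=
  (innerSL ℝ (restrictL2 h u)).comp (W01.toL2CLM hω)

/-! ### Time partition and the projection in time -/

/-- The reference weights `p j`, `0 ≤ j ≤ k`. -/
noncomputable def localDual (k : ℕ) : ℕ → ℝ[X] := (exists_localDual k).choose

lemma localDual_spec (k : ℕ) : IsLocalDual k (localDual k) := (exists_localDual k).choose_spec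

/-- A partition `0 = t_0 < t_1 < ⋯ < t_N = T` of the time interval into the closed intervals
`[t_n, t_{n+1}]`, `n < N`. -/
structure TimeMesh (T : ℝ) where
  N : ℕ
  node : ℕ → ℝ
  node_zero : node 0 = 0
  node_last : node N = T
  node_lt : ∀ n < N, node n < node (n + 1)

namespace TimeMesh

variable {T : ℝ} (M : TimeMesh T)

/-- The closed time interval with number `n`. -/
def K (n : ℕ) : Set ℝ := Icc (M.node n) (M.node (n + 1))

/-- Its length. -/
def h (n : ℕ) : ℝ := M.node (n + 1) - M.node n

/-- The element patch: the union of all intervals of the partition that meet `K n`. -/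
def patch (n : ℕ) : Set ℝ := ⋃ n' ∈ {n' | n' < M.N ∧ (M.K n ∩ M.K n').Nonempty}, M.K n'

/-- Shape regularity with constant `κ` (the bound `h n ≤ |patch n|` always holds). -/
def ShapeRegular (κ : ℝ) : Prop := ∀ n < M.N, volume.real (M.patch n) ≤ κ * M.h n

/-- The local coordinate in `K n`. -/
noncomputable def loc (n : ℕ) (t : ℝ) : ℝ := (t - M.node n) / M.h n

/-- The Lagrange nodes of order `k` are numbered by `0, …, N * k` from left to right; the node `i`
lies in `K n` iff `n * k ≤ i ≤ (n + 1) * k`, and then it has the local number `i - n * k`. -/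
def nodeMem (k i n : ℕ) : Prop := n * k ≤ i ∧ i ≤ (n + 1) * k

/-- Half open intervals (closed for `n = 0`), which decompose `[0, T]` disjointly; used to paste
functions that are given on each of the closed intervals. -/
def cell (n : ℕ) : Set ℝ :=
  if n = 0 then Icc (M.node 0) (M.node 1) else Ioc (M.node n) (M.node (n + 1))

open Classical in
/-- The global function on `[0, T]` that belongs to the Lagrange node `i` and is on each interval
that contains this node the transformed local polynomial with the local number of the node, and
zero on all other intervals. -/
noncomputable def paste (k : ℕ) (p : ℕ → ℝ[X]) (i : ℕ) (t : ℝ) : ℝ :=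
  ∑ n ∈ Finset.range M.N, if nodeMem k i n then
    (M.cell n).indicator (fun t => (p (i - n * k)).eval (M.loc n t)) t else 0

/-- The global Bernstein basis function of the Lagrange node `i`. -/
noncomputable def bern (k i : ℕ) : ℝ → ℝ := M.paste k (bernsteinPolynomial ℝ k) i

open Classical in
/-- The length of the support of `bern k i`, the union of the intervals that contain the node. -/
noncomputable def nodeLen (k i : ℕ) : ℝ :=
  ∑ n ∈ Finset.range M.N, if nodeMem k i n then M.h n else 0

/-- The global dual basis function of the Lagrange node `i`. -/
noncomputable def psi (k i : ℕ) (t : ℝ) : ℝ := (M.nodeLen k i)⁻¹ * M.paste k (localDual k) i t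

/-- The Scott-Zhang type projection in time, applied to a vector-valued function:
`Π v = ∑ i, ⟨v, ψ i⟩ b i`. -/
noncomputable def proj {Y : Type*} [NormedAddCommGroup Y] [NormedSpace ℝ Y] (k : ℕ) (v : ℝ → Y)
    (t : ℝ) : Y :=
  ∑ i ∈ Finset.range (M.N * k + 1), M.bern k i t • ∫ σ in Ioo 0 T, M.psi k i σ • v σ

end TimeMesh

/-! ### Bochner-Sobolev norms in time -/

/-- `g` is the `m`-th weak derivative of `f` on the open set `U`. -/
def IsWeakDeriv {X : Type*} [NormedAddCommGroup X] [NormedSpace ℝ X] (m : ℕ) (U : Set ℝ)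
    (f g : ℝ → X) : Prop :=
  LocallyIntegrableOn f U ∧ LocallyIntegrableOn g U ∧
  ∀ φ : ℝ → ℝ, ContDiff ℝ (⊤ : ℕ∞) φ → HasCompactSupport φ → tsupport φ ⊆ U →
    ∫ t in U, iteratedDeriv m φ t • f t = (-1 : ℝ) ^ m • ∫ t in U, φ t • g t

/-- `‖∂_t^m f‖_{L²(I; X)}` for an interval `I`; it takes the value `∞` if there is no such weak
derivative or if it is not square integrable. -/
noncomputable def derivNorm {X : Type*} [NormedAddCommGroup X] [NormedSpace ℝ X] (m : ℕ)
    (I : Set ℝ) (f : ℝ → X) : ℝ≥0∞ :=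
  ⨅ (g : ℝ → X) (_ : IsWeakDeriv m (interior I) f g), eLpNorm g 2 (volume.restrict I)

/-- The space `V = L²(0,T; W_0^{1,2}(Ω)) ∩ W^{1,2}(0,T; W^{-1,2}(Ω))`, as a set of functions of
time with values in `L²(Ω)`. -/
def V {d : ℕ} [NeZero d] (T : ℝ) {Ω : Set (Euc d)} (hΩ : Bornology.IsBounded Ω) :
    Set (ℝ → L2 Ω) :=
  {v | (∃ w : ℝ → W01 Ω, MemLp w 2 (volume.restrict (Ioo 0 T)) ∧
      ∀ᵐ t ∂volume.restrict (Ioo 0 T), v t = W01.toL2 (w t)) ∧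
    derivNorm 1 (Ioo 0 T) (fun t => toWneg hΩ subset_rfl (v t)) < ∞}

/-! ### Triangulations in space -/

/-- `S` is a regular (conforming) partition of `Ω` into finitely many closed `d`-simplices: each
face of the complex is a face of a `d`-simplex, and the simplices cover the closure of `Ω`. -/
structure IsTriangulation {d : ℕ} (S : Geometry.SimplicialComplex ℝ (Euc d))
    (Ω : Set (Euc d)) : Prop where
  finite : S.faces.Finite
  pure : ∀ s ∈ S.faces, ∃ t ∈ S.faces, s ⊆ t ∧ t.card = d + 1
  space_eq : S.space = closure Ω

/-- The closed `d`-simplices of the triangulation. -/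
def simplices {d : ℕ} (S : Geometry.SimplicialComplex ℝ (Euc d)) : Set (Set (Euc d)) :=
  {K | ∃ s ∈ S.faces, s.card = d + 1 ∧ K = convexHull ℝ (s : Set (Euc d))}

end SpaceTime

namespace SpaceTime

/-! The estimate is proved once for integrable functions `f` with values in an arbitrary Banach
space, and then transferred to the two kinds of `X`.

Let `(a, b)` be the interior of the patch of `K n` and let `g` be an `s`-th weak derivative of `f`
there, square integrable without loss of generality. By the du Bois-Reymond lemma, Taylor's formula
holds: `f = P + R` a.e. on `(a, b)`, where `P` is a polynomial of degree less than `s` with vector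
coefficients and `R` is the `s`-fold primitive of `g` from `a` (`exists_taylor`). On `K n` the
projection sees `f` only on the patch (`TimeMesh.coef_congr`). It also reproduces `P`, since `s ≤ k
+ 1` (`TimeMesh.sum_bernstein_smul_coef_sum`): biorthogonality returns the Bernstein coefficients on
each interval, and the intervals at a common node agree on its coefficient because `P` is
continuous. Hence `f - Π f = R - Π R` on `K n`, which yields an explicit `m`-th weak derivative
(`TimeMesh.isWeakDeriv_sub_proj`).

Its two parts are estimated separately. The derivative of `R` is the `(s - m)`-fold primitive of
`g`, and each primitive gains a factor `b - a` (`memLp_iterPrim`). The projection of `R` is a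
Bernstein sum with coefficients bounded by `h⁻¹ ∫ ‖R‖`, and differentiating it costs `h⁻¹ ^ m`
(`TimeMesh.eLpNorm_sum_derivative_smul_coef_le`). Shape regularity replaces `b - a` by `κ h`.

For the transfer, Friedrichs' inequality makes `v` integrable with values in `L²(Ω)`, and the
projection commutes with the bounded maps from `L²(Ω)` to `X` (`TimeMesh.map_proj`). -/

/-! ### Test functions on the line -/

/-- `φ` is a test function on `U`. -/
structure IsTest (U : Set ℝ) (φ : ℝ → ℝ) : Prop where
  contDiff : ContDiff ℝ (⊤ : ℕ∞) φ
  hasCompactSupport : HasCompactSupport φ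
  tsupport_subset : tsupport φ ⊆ U

namespace IsTest

variable {U W : Set ℝ} {φ η : ℝ → ℝ}

lemma mono (h : IsTest U φ) (hUW : U ⊆ W) : IsTest W φ :=
  ⟨h.1, h.2, h.3.trans hUW⟩

lemma eq_zero (h : IsTest U φ) {t : ℝ} (ht : t ∉ U) : φ t = 0 :=
  image_eq_zero_of_notMem_tsupport fun h' => ht (h.3 h')

protected lemma deriv (h : IsTest U φ) : IsTest U (deriv φ) :=
  ⟨(contDiff_infty_iff_deriv.1 h.1).2, h.2.deriv, (tsupport_deriv_subset (𝕜 := ℝ)).trans h.3⟩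

protected lemma iteratedDeriv (h : IsTest U φ) (m : ℕ) : IsTest U (iteratedDeriv m φ) := by
  induction m with
  | zero => simpa using h
  | succ m ih => rw [iteratedDeriv_succ]; exact ih.deriv

lemma differentiable (h : IsTest U φ) : Differentiable ℝ φ := h.1.differentiable (by simp)

lemma sub (h : IsTest U φ) (k : IsTest U η) : IsTest U (φ - η) :=
  ⟨h.1.sub k.1, h.2.sub k.2, (tsupport_sub _ _).trans (union_subset h.3 k.3)⟩

lemma const_smul (h : IsTest U φ) (c : ℝ) : IsTest U (c • φ) :=
  ⟨h.1.const_smul c, h.2.smul_left (f := fun _ => c),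
    (closure_mono (Function.support_const_smul_subset c φ)).trans h.3⟩

lemma integrable (h : IsTest U φ) : Integrable φ :=
  h.1.continuous.integrable_of_hasCompactSupport h.2

section

variable {X : Type*} [NormedAddCommGroup X] [NormedSpace ℝ X] {f : ℝ → X}

lemma setIntegral_smul (h : IsTest U φ) (f : ℝ → X) :
    ∫ t in U, φ t • f t = ∫ t, φ t • f t :=
  setIntegral_eq_integral_of_forall_compl_eq_zero fun t ht => by rw [h.eq_zero ht, zero_smul]

lemma integrable_smul (h : IsTest U φ) (hf : LocallyIntegrableOn f U) :
    Integrable fun t => φ t • f t := by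
  have hf' : IntegrableOn f (tsupport φ) :=
    hf.integrableOn_compact_subset h.3 h.2
  have h1 : IntegrableOn (fun t => φ t • f t) (tsupport φ) :=
    hf'.continuousOn_smul h.1.continuous.continuousOn h.2
  refine (integrableOn_iff_integrable_of_support_subset ?_).1 h1
  exact (Function.support_smul_subset_left _ _).trans (subset_tsupport φ)

end

/-- A test function on an interval with vanishing integral is the derivative of a test function. -/
lemma exists_deriv_eq {a b : ℝ} (h : IsTest (Ioo a b) φ) (h0 : ∫ t, φ t = 0) :
    ∃ η, IsTest (Ioo a b) η ∧ deriv η = φ := by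
  -- A nonempty support has a least and a greatest point; they bound the support of the primitive,
  -- which keeps it away from `a` and `b`.
  rcases (tsupport φ).eq_empty_or_nonempty with he | hne
  · have : φ = 0 := tsupport_eq_empty_iff.1 he
    subst this
    exact ⟨0, h, by ext; simp⟩
  obtain ⟨a', ha', hla⟩ := h.2.isCompact.exists_isLeast hne
  obtain ⟨b', hb', hgb⟩ := h.2.isCompact.exists_isGreatest hne
  have hz : ∀ t, t ∉ Icc a' b' → φ t = 0 := fun t ht =>
    image_eq_zero_of_notMem_tsupport fun h' => ht ⟨hla h', hgb h'⟩
  have hd : ∀ t, HasDerivAt (fun t => ∫ σ in a..t, φ σ) (φ t) t := fun t =>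
    h.1.continuous.integral_hasStrictDerivAt a t |>.hasDerivAt
  have hderiv : deriv (fun t => ∫ σ in a..t, φ σ) = φ := funext fun t => (hd t).deriv
  have ha := h.3 ha'
  have hb := h.3 hb'
  have hsupp : Function.support (fun t => ∫ σ in a..t, φ σ) ⊆ Icc a' b' := by
    intro t ht
    by_contra hnot
    apply ht
    rw [mem_Icc, not_and_or, not_le, not_le] at hnot
    rcases hnot with h1 | h1
    · refine intervalIntegral.integral_zero_ae (Filter.Eventually.of_forall fun σ hσ => ?_)
      apply hz
      rw [mem_uIoc] at hσ
      rintro ⟨h2, -⟩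
      rcases hσ with hσ | hσ <;> linarith [ha.1]
    · change ∫ σ in a..t, φ σ = 0
      -- To the right of the support the primitive has already collected the whole integral, which
      -- is zero.
      rw [← h0, intervalIntegral.integral_of_le (by linarith [hb.1])]
      refine setIntegral_eq_integral_of_forall_compl_eq_zero fun σ hσ => hz σ fun h2 => hσ ?_
      exact ⟨by linarith [h2.1, ha.1], by linarith [h2.2]⟩
  have hts : tsupport (fun t => ∫ σ in a..t, φ σ) ⊆ Icc a' b' :=
    closure_minimal hsupp isClosed_Icc
  refine ⟨_, ⟨?_, ?_, ?_⟩, hderiv⟩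
  · rw [contDiff_infty_iff_deriv, hderiv]
    exact ⟨fun t => (hd t).differentiableAt, h.1⟩
  · exact HasCompactSupport.intro' isCompact_Icc isClosed_Icc fun t ht => by
      by_contra h'
      exact ht (hsupp h')
  · exact hts.trans fun t ht => ⟨ha.1.trans_le ht.1, ht.2.trans_lt hb.2⟩

lemma exists_integral_eq_one {a b : ℝ} (hab : a < b) :
    ∃ θ, IsTest (Ioo a b) θ ∧ ∫ t, θ t = 1 := by
  -- An outer radius of a quarter of the length keeps the closed ball around the midpoint inside the
  -- open interval.
  let B : ContDiffBump ((a + b) / 2) :=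
    ⟨(b - a) / 8, (b - a) / 4, by linarith, by linarith⟩
  refine ⟨B.normed volume, ⟨B.contDiff_normed, B.hasCompactSupport_normed, ?_⟩,
    B.integral_normed⟩
  rw [B.tsupport_normed_eq, Real.closedBall_eq_Icc]
  intro t ht
  simp only [B, mem_Icc] at ht
  constructor <;> linarith [ht.1, ht.2]

end IsTest

/-! ### Weak derivatives -/

lemma locallyIntegrableOn_congr {X : Type*} [NormedAddCommGroup X] {f f' : ℝ → X} {U : Set ℝ}
    (h : LocallyIntegrableOn f U)
    (hf : f =ᵐ[volume.restrict U] f') : LocallyIntegrableOn f' U := fun x hx => by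
  obtain ⟨s, hs, hi⟩ := h x hx
  refine ⟨s ∩ U, Filter.inter_mem hs self_mem_nhdsWithin, ?_⟩
  refine (hi.mono_set inter_subset_left).congr_fun_ae ?_
  exact ae_restrict_of_ae_restrict_of_subset inter_subset_right hf

section Weak

variable {X : Type*} [NormedAddCommGroup X] [NormedSpace ℝ X] {U W : Set ℝ} {m : ℕ}
  {f g f' g' : ℝ → X}

/-- Test functions on `U` vanish off `U`, so the integrals may run over the whole line; this makes
restriction to a smaller set immediate. -/
lemma isWeakDeriv_iff : IsWeakDeriv m U f g ↔ LocallyIntegrableOn f U ∧ LocallyIntegrableOn g U ∧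
    ∀ φ, IsTest U φ → ∫ t, iteratedDeriv m φ t • f t = (-1 : ℝ) ^ m • ∫ t, φ t • g t := by
  refine and_congr_right fun _ => and_congr_right fun _ => ⟨fun h φ hφ => ?_, fun h φ h1 h2 h3 => ?_⟩
  · rw [← (hφ.iteratedDeriv m).setIntegral_smul, ← hφ.setIntegral_smul]
    exact h φ hφ.1 hφ.2 hφ.3
  · have hφ : IsTest U φ := ⟨h1, h2, h3⟩
    rw [(hφ.iteratedDeriv m).setIntegral_smul, hφ.setIntegral_smul]
    exact h φ hφ

lemma IsWeakDeriv.mono (h : IsWeakDeriv m U f g) (hWU : W ⊆ U) : IsWeakDeriv m W f g := by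
  rw [isWeakDeriv_iff] at h ⊢
  exact ⟨h.1.mono_set hWU, h.2.1.mono_set hWU, fun φ hφ => h.2.2 φ (hφ.mono hWU)⟩

lemma IsWeakDeriv.sub (h : IsWeakDeriv m U f g) (h' : IsWeakDeriv m U f' g') :
    IsWeakDeriv m U (f - f') (g - g') := by
  rw [isWeakDeriv_iff] at h h' ⊢
  refine ⟨h.1.sub h'.1, h.2.1.sub h'.2.1, fun φ hφ => ?_⟩
  simp only [Pi.sub_apply, smul_sub]
  rw [integral_sub ((hφ.iteratedDeriv m).integrable_smul h.1)
      ((hφ.iteratedDeriv m).integrable_smul h'.1),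
    integral_sub (hφ.integrable_smul h.2.1) (hφ.integrable_smul h'.2.1), h.2.2 φ hφ, h'.2.2 φ hφ,
    smul_sub]

lemma IsWeakDeriv.congr (h : IsWeakDeriv m U f g)
    (hf : f =ᵐ[volume.restrict U] f') : IsWeakDeriv m U f' g := by
  refine ⟨locallyIntegrableOn_congr h.1 hf, h.2.1, fun φ h1 h2 h3 => ?_⟩
  rw [← h.2.2 φ h1 h2 h3]
  refine integral_congr_ae ?_
  filter_upwards [hf] with t ht
  rw [ht]

lemma IsWeakDeriv.sum {ι : Type*} (s : Finset ι) {F G : ι → ℝ → X}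
    (h : ∀ i ∈ s, IsWeakDeriv m U (F i) (G i)) :
    IsWeakDeriv m U (fun t => ∑ i ∈ s, F i t) (fun t => ∑ i ∈ s, G i t) := by
  simp only [isWeakDeriv_iff] at h ⊢
  have hs : ∀ {H : ι → ℝ → X}, (∀ i ∈ s, LocallyIntegrableOn (H i) U) →
      LocallyIntegrableOn (fun t => ∑ i ∈ s, H i t) U := by
    intro H hH
    classical
    induction s using Finset.induction_on with
    | empty => simpa using locallyIntegrableOn_zero
    | insert i s hi ih =>
      simp only [Finset.sum_insert hi]
      exact (hH i (by simp)).add (ih (fun j hj => h j (by simp [hj])) fun j hj => hH j (by simp [hj]))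
  refine ⟨hs fun i hi => (h i hi).1, hs fun i hi => (h i hi).2.1, fun φ hφ => ?_⟩
  simp only [Finset.smul_sum]
  rw [integral_finsetSum _ fun i hi => (hφ.iteratedDeriv m).integrable_smul (h i hi).1,
    integral_finsetSum _ fun i hi => hφ.integrable_smul (h i hi).2.1, Finset.smul_sum]
  exact Finset.sum_congr rfl fun i hi => (h i hi).2.2 φ hφ

/-- Scalar integration by parts, repeated `m` times, has no boundary terms because the test function
has compact support. It serves both for monomials and for the transported Bernstein polynomials. -/
lemma isWeakDeriv_smul_const [CompleteSpace X] (U : Set ℝ) {ρ : ℝ → ℝ} (hρ : ContDiff ℝ (⊤ : ℕ∞) ρ) (x : X) (m : ℕ) :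
    IsWeakDeriv m U (fun t => ρ t • x) (fun t => iteratedDeriv m ρ t • x) := by
  rw [isWeakDeriv_iff]
  have hl : ∀ {χ : ℝ → ℝ}, Continuous χ → LocallyIntegrableOn (fun t => χ t • x) U := fun hχ =>
    ((hχ.smul continuous_const).locallyIntegrable).locallyIntegrableOn U
  refine ⟨hl hρ.continuous, hl (hρ.continuous_iteratedDeriv m (by exact_mod_cast le_top)),
    fun φ hφ => ?_⟩
  have key : ∫ t, iteratedDeriv m φ t * ρ t = (-1) ^ m * ∫ t, φ t * iteratedDeriv m ρ t := by
    induction m generalizing φ with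
    | zero => simp
    | succ m ih =>
      have hc : ∀ j : ℕ, ContDiff ℝ (⊤ : ℕ∞) (iteratedDeriv j ρ) := fun j => by
        rw [iteratedDeriv_eq_iterate]; exact hρ.iterate_deriv j
      have hI : ∀ {χ ζ : ℝ → ℝ}, IsTest U χ → Continuous ζ → Integrable (χ * ζ) := fun hχ hζ =>
        (hχ.1.continuous.mul hζ).integrable_of_hasCompactSupport hχ.2.mul_right
      rw [iteratedDeriv_succ', ih _ hφ.deriv, iteratedDeriv_succ]
      have := integral_mul_deriv_eq_deriv_mul_of_integrable (u := φ) (v := iteratedDeriv m ρ)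
        (u' := deriv φ) (v' := deriv (iteratedDeriv m ρ))
        (fun t _ => (hφ.differentiable t).hasDerivAt)
        (fun t _ => (((hc m).differentiable (by simp)) t).hasDerivAt)
        (hI hφ (contDiff_infty_iff_deriv.1 (hc m)).2.continuous)
        (hI hφ.deriv (hc m).continuous) (hI hφ (hc m).continuous)
      rw [this, pow_succ]
      ring
  simp only [smul_smul]
  rw [integral_smul_const, integral_smul_const, smul_smul, key]

end Weak

/-! ### Iterated primitives -/

/-! ### Norm comparisons on a bounded interval -/

section Interval

variable {X : Type*} [NormedAddCommGroup X] {a b : ℝ} {g : ℝ → X}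

lemma eLpNorm_one_le_Ioo (hab : a ≤ b) (hg : AEStronglyMeasurable g (volume.restrict (Ioo a b))) :
    eLpNorm g 1 (volume.restrict (Ioo a b)) ≤
      eLpNorm g 2 (volume.restrict (Ioo a b)) * ENNReal.ofReal ((b - a) ^ (1 / 2 : ℝ)) := by
  refine (eLpNorm_le_eLpNorm_mul_rpow_measure_univ (p := 1) (q := 2) (by norm_num) hg).trans ?_
  rw [Measure.restrict_apply_univ, Real.volume_Ioo,
    ENNReal.ofReal_rpow_of_nonneg (by linarith) (by norm_num)]
  norm_num

/-- Cauchy's inequality for the integral of the norm. -/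
lemma integral_norm_le_sqrt_mul_eLpNorm (hab : a ≤ b) (hg : MemLp g 2 (volume.restrict (Ioo a b))) :
    ∫ t in Ioo a b, ‖g t‖ ≤
      (b - a) ^ (1 / 2 : ℝ) * (eLpNorm g 2 (volume.restrict (Ioo a b))).toReal := by
  have h := ENNReal.toReal_mono (ENNReal.mul_ne_top hg.2.ne ENNReal.ofReal_ne_top)
    (eLpNorm_one_le_Ioo hab hg.1)
  rw [ENNReal.toReal_mul, ENNReal.toReal_ofReal (Real.rpow_nonneg (by linarith) _), mul_comm] at h
  rwa [integral_norm_eq_lintegral_enorm hg.1, ← eLpNorm_one_eq_lintegral_enorm]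

/-- A bounded function on an interval. -/
lemma eLpNorm_two_le_of_bound (hab : a ≤ b) {c : ℝ}
    (hg : ∀ t ∈ Ioo a b, ‖g t‖ ≤ c) :
    eLpNorm g 2 (volume.restrict (Ioo a b)) ≤ ENNReal.ofReal ((b - a) ^ (1 / 2 : ℝ) * c) := by
  refine (eLpNorm_le_of_ae_bound (C := c)
    ((ae_restrict_iff' measurableSet_Ioo).2 (Filter.Eventually.of_forall hg))).trans ?_
  rw [Measure.restrict_apply_univ, Real.volume_Ioo,
    ENNReal.ofReal_rpow_of_nonneg (by linarith) (by norm_num),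
    ENNReal.ofReal_mul (Real.rpow_nonneg (by linarith) _)]
  norm_num

end Interval

section Prim

variable {X : Type*} [NormedAddCommGroup X] [NormedSpace ℝ X] {a b : ℝ}
  {f g : ℝ → X}

/-- Integration by parts for the primitive of an integrable function. -/
lemma integral_deriv_smul_primitive [CompleteSpace X] (hg : IntegrableOn g (Ioo a b)) {φ : ℝ → ℝ}
    (hφ : IsTest (Ioo a b) φ) :
    ∫ t, deriv φ t • ∫ σ in a..t, g σ = -∫ t, φ t • g t := by
  -- The condition `σ ≤ t` is read once as a condition on `σ` and once on `t`, so that Fubini's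
  -- theorem can exchange the integrals over the triangle.
  have hind : ∀ t σ, (Iic t).indicator g σ = (Ici σ).indicator (fun _ => g σ) t := by
    intro t σ
    by_cases h : σ ≤ t <;> simp [h]
  have e1 : ∫ t, deriv φ t • ∫ σ in a..t, g σ
      = ∫ t in Ioo a b, ∫ σ in Ioo a b, deriv φ t • (Iic t).indicator g σ := by
    rw [← hφ.deriv.setIntegral_smul]
    refine setIntegral_congr_fun measurableSet_Ioo fun t ht => ?_
    rw [integral_smul, setIntegral_indicator measurableSet_Iic,
      intervalIntegral.integral_of_le ht.1.le]
    congr 3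
    ext σ
    simp only [mem_Ioc, mem_inter_iff, mem_Ioo, mem_Iic]
    exact ⟨fun h => ⟨⟨h.1, h.2.trans_lt ht.2⟩, h.2⟩, fun h => ⟨h.1.1, h.2⟩⟩
  have hint : Integrable (Function.uncurry fun t σ => deriv φ t • (Iic t).indicator g σ)
      ((volume.restrict (Ioo a b)).prod (volume.restrict (Ioo a b))) := by
    have h1 : Integrable (fun z : ℝ × ℝ => deriv φ z.1 • g z.2)
        ((volume.restrict (Ioo a b)).prod (volume.restrict (Ioo a b))) :=
      hφ.deriv.integrable.integrableOn.smul_prod hg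
    refine (h1.indicator (s := {z : ℝ × ℝ | z.2 ≤ z.1})
      (measurableSet_le measurable_snd measurable_fst)).congr
      (Filter.Eventually.of_forall fun z => ?_)
    by_cases h : z.2 ≤ z.1 <;> simp [Function.uncurry, h]
  rw [e1, integral_integral_swap hint, ← hφ.setIntegral_smul, ← integral_neg]
  refine setIntegral_congr_fun measurableSet_Ioo fun σ hσ => ?_
  have e2 : ∀ t, deriv φ t • (Ici σ).indicator (fun _ => g σ) t
      = (Ici σ).indicator (fun t => deriv φ t • g σ) t := fun t => by
    by_cases h : σ ≤ t <;> simp [h]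
  simp only [hind, e2]
  rw [setIntegral_indicator measurableSet_Ici, integral_smul_const, ← neg_smul]
  congr 1
  -- The inner integral of `deriv φ` from `σ` to `b` is `-φ σ`, since `φ` vanishes at `b`.
  have e3 : Ioo a b ∩ Ici σ = Ico σ b := by
    ext t
    simp only [mem_inter_iff, mem_Ioo, mem_Ici, mem_Ico]
    exact ⟨fun h => ⟨h.2, h.1.2⟩, fun h => ⟨⟨hσ.1.trans_le h.1, h.2⟩, h.1⟩⟩
  rw [e3, integral_Ico_eq_integral_Ioo, ← integral_Ioc_eq_integral_Ioo,
    ← intervalIntegral.integral_of_le hσ.2.le,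
    intervalIntegral.integral_deriv_eq_sub (fun t _ => hφ.differentiable t)
      (hφ.deriv.1.continuous.intervalIntegrable _ _), hφ.eq_zero (t := b) (by simp), zero_sub]

/-- The `j`-th iterated primitive of `g` with starting point `a`. -/
noncomputable def iterPrim (a : ℝ) (g : ℝ → X) : ℕ → ℝ → X
  | 0 => g
  | j + 1 => fun t => ∫ σ in a..t, iterPrim a g j σ

lemma continuousOn_primitive_Ioo (hg : IntegrableOn g (Ioo a b)) :
    ContinuousOn (fun t => ∫ σ in a..t, g σ) (Icc a b) := by
  rcases le_total a b with hab | hab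
  · rw [← uIcc_of_le hab]
    refine intervalIntegral.continuousOn_primitive_interval ?_
    rwa [uIcc_of_le hab, integrableOn_Icc_iff_integrableOn_Ioo]
  · refine (continuousOn_singleton _ a).mono fun t ht => ?_
    exact le_antisymm (ht.2.trans hab) ht.1

lemma integrableOn_iterPrim (hg : IntegrableOn g (Ioo a b)) (j : ℕ) :
    IntegrableOn (iterPrim a g j) (Ioo a b) := by
  induction j with
  | zero => exact hg
  | succ j ih =>
    exact ((continuousOn_primitive_Ioo ih).integrableOn_compact isCompact_Icc).mono_set
      Ioo_subset_Icc_self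

/-- Each integration by parts removes one primitive, by `integral_deriv_smul_primitive`. -/
lemma isWeakDeriv_iterPrim [CompleteSpace X] (hg : IntegrableOn g (Ioo a b)) {m s : ℕ} (hms : m ≤ s) :
    IsWeakDeriv m (Ioo a b) (iterPrim a g s) (iterPrim a g (s - m)) := by
  rw [isWeakDeriv_iff]
  refine ⟨(integrableOn_iterPrim hg s).locallyIntegrableOn,
    (integrableOn_iterPrim hg _).locallyIntegrableOn, fun φ hφ => ?_⟩
  induction m generalizing φ with
  | zero => simp
  | succ m ih =>
    rw [iteratedDeriv_succ', ih (by omega) _ hφ.deriv]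
    obtain ⟨j, hj⟩ : ∃ j, s - m = j + 1 := ⟨s - m - 1, by omega⟩
    have hj' : s - (m + 1) = j := by omega
    rw [hj, hj']
    simp only [iterPrim]
    rw [integral_deriv_smul_primitive (integrableOn_iterPrim hg j) hφ, pow_succ, mul_neg_one,
      neg_smul, smul_neg]

/-- By Cauchy's inequality the primitive is bounded pointwise by `(b - a)^(1/2)` times the norm of
`g`; the `L²` norm of a bounded function contributes the second square root. -/
lemma eLpNorm_primitive_le (hab : a ≤ b) (hg : MemLp g 2 (volume.restrict (Ioo a b))) :
    eLpNorm (fun t => ∫ σ in a..t, g σ) 2 (volume.restrict (Ioo a b)) ≤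
      ENNReal.ofReal (b - a) * eLpNorm g 2 (volume.restrict (Ioo a b)) := by
  have hint : IntegrableOn g (Ioo a b) := hg.integrable (by norm_num)
  refine (eLpNorm_two_le_of_bound hab (c := (b - a) ^ (1 / 2 : ℝ) *
    (eLpNorm g 2 (volume.restrict (Ioo a b))).toReal) fun t ht => ?_).trans (le_of_eq ?_)
  · refine le_trans ?_ (integral_norm_le_sqrt_mul_eLpNorm hab hg)
    rw [intervalIntegral.integral_of_le ht.1.le]
    refine (norm_integral_le_integral_norm _).trans ?_
    exact setIntegral_mono_set hint.norm (Filter.Eventually.of_forall fun _ => norm_nonneg _)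
      (LE.le.eventuallyLE fun σ hσ => ⟨hσ.1, hσ.2.trans_lt ht.2⟩)
  · rw [← mul_assoc, ← Real.rpow_add_of_nonneg (by linarith) (by norm_num) (by norm_num),
      ENNReal.ofReal_mul (Real.rpow_nonneg (by linarith) _), ENNReal.ofReal_toReal hg.2.ne]
    norm_num

lemma memLp_iterPrim (hab : a ≤ b) (hg : MemLp g 2 (volume.restrict (Ioo a b))) (j : ℕ) :
    MemLp (iterPrim a g j) 2 (volume.restrict (Ioo a b)) ∧
    eLpNorm (iterPrim a g j) 2 (volume.restrict (Ioo a b)) ≤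
      ENNReal.ofReal ((b - a) ^ j) * eLpNorm g 2 (volume.restrict (Ioo a b)) := by
  induction j with
  | zero => exact ⟨hg, by simp [iterPrim]⟩
  | succ j ih =>
    have h := eLpNorm_primitive_le hab ih.1
    refine ⟨⟨(integrableOn_iterPrim (hg.integrable (by norm_num)) (j + 1)).1,
      h.trans_lt (ENNReal.mul_lt_top ENNReal.ofReal_lt_top ih.1.2)⟩, h.trans ?_⟩
    rw [pow_succ', ENNReal.ofReal_mul (by linarith), mul_assoc]
    gcongr
    exact ih.2

/-! ### The du Bois-Reymond lemma and Taylor's formula -/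

lemma iteratedDeriv_pow_self (m : ℕ) :
    iteratedDeriv m (fun t : ℝ => t ^ m) = fun _ => (m.factorial : ℝ) := by
  induction m with
  | zero => ext; simp
  | succ m ih =>
    have hd : deriv (fun t : ℝ => t ^ (m + 1)) = ((m + 1 : ℕ) : ℝ) • fun t : ℝ => t ^ m := by
      ext t
      simp
    ext t
    rw [iteratedDeriv_succ', hd, iteratedDeriv_const_smul_field, ih, Nat.factorial_succ]
    simp

/-- A function whose weak `m`-th derivative vanishes is a polynomial of degree less than `m`. -/
lemma ae_eq_polynomial_of_isWeakDeriv_zero [CompleteSpace X] (hab : a < b) (m : ℕ)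
    (h : IsWeakDeriv m (Ioo a b) f 0) :
    ∃ c : ℕ → X, f =ᵐ[volume.restrict (Ioo a b)] fun t => ∑ i ∈ Finset.range m, t ^ i • c i := by
  induction m generalizing f with
  | zero =>
    refine ⟨0, ?_⟩
    rw [isWeakDeriv_iff] at h
    have := isOpen_Ioo.ae_eq_zero_of_integral_contDiff_smul_eq_zero h.1 fun φ h1 h2 h3 => by
      simpa using h.2.2 φ ⟨h1, h2, h3⟩
    simpa [Filter.EventuallyEq] using (ae_restrict_iff' measurableSet_Ioo).2 this
  | succ m ih =>
    obtain ⟨θ, hθ, hθ1⟩ := IsTest.exists_integral_eq_one hab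
    have hw := isWeakDeriv_iff.1 h
    -- The `m`-th weak derivative of `f` should be a constant, which testing against `θ` of integral
    -- one identifies as `(-1)^m ∫ θ^(m) f`. The factorial makes `t ^ m • c` have exactly this
    -- `m`-th derivative.
    set c : X := ((-1 : ℝ) ^ m * (m.factorial : ℝ)⁻¹) • ∫ t, iteratedDeriv m θ t • f t with hc
    have hq := isWeakDeriv_smul_const (Ioo a b) (ρ := fun t => t ^ m) (by fun_prop) c m
    have hq' := isWeakDeriv_iff.1 hq
    have hsub : IsWeakDeriv m (Ioo a b) (f - fun t => t ^ m • c) 0 := by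
      rw [isWeakDeriv_iff]
      refine ⟨hw.1.sub hq.1, hw.2.1, fun φ hφ => ?_⟩
      -- After this correction the test function has mean zero, hence is `deriv η`. Testing the
      -- hypothesis of order `m + 1` with `η` gives `∫ φ^(m) f = (∫ φ) ∫ θ^(m) f`.
      have hχ : IsTest (Ioo a b) (φ - (∫ t, φ t) • θ) := hφ.sub (hθ.const_smul _)
      obtain ⟨η, hη, hηd⟩ := hχ.exists_deriv_eq (by
        simp only [Pi.sub_apply, Pi.smul_apply]
        rw [integral_sub hφ.integrable (hθ.integrable.fun_smul _), integral_smul, hθ1]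
        simp)
      have h1 := hw.2.2 η hη
      have hcd : ∀ {χ : ℝ → ℝ}, IsTest (Ioo a b) χ → ∀ t, ContDiffAt ℝ m χ t := fun hχ t =>
        (hχ.1.of_le (by exact_mod_cast le_top)).contDiffAt
      rw [iteratedDeriv_succ', hηd] at h1
      have h2 : ∀ t, iteratedDeriv m (φ - (∫ t, φ t) • θ) t • f t
          = iteratedDeriv m φ t • f t - (∫ t, φ t) • iteratedDeriv m θ t • f t := by
        intro t
        rw [iteratedDeriv_sub (hcd hφ t) (hcd (hθ.const_smul _) t),
          iteratedDeriv_const_smul_field, sub_smul, smul_assoc]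
      simp only [h2] at h1
      rw [integral_sub ((hφ.iteratedDeriv m).integrable_smul hw.1)
        (((hθ.iteratedDeriv m).integrable_smul hw.1).fun_smul _), integral_smul] at h1
      have h3 := hq'.2.2 φ hφ
      simp only [Pi.sub_apply, smul_sub]
      rw [integral_sub ((hφ.iteratedDeriv m).integrable_smul hw.1)
        ((hφ.iteratedDeriv m).integrable_smul hq.1), h3, iteratedDeriv_pow_self]
      have h4 : ∫ t, φ t • (m.factorial : ℝ) • c = ((∫ t, φ t) * (m.factorial : ℝ)) • c := by
        simp only [smul_smul]
        rw [integral_smul_const, integral_mul_const]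
      rw [h4, hc]
      simp only [Pi.zero_apply, smul_zero, integral_zero, smul_smul] at h1 ⊢
      have h5 : (-1 : ℝ) ^ m * ((∫ t, φ t) * (m.factorial : ℝ) * ((-1) ^ m * (m.factorial : ℝ)⁻¹)) = ∫ t, φ t := by
        have : (m.factorial : ℝ) ≠ 0 := by positivity
        have h6 : (-1 : ℝ) ^ m * (-1) ^ m = 1 := by rw [← mul_pow]; simp
        field_simp
        linear_combination (∫ t, φ t) * h6
      rw [← mul_assoc] at h5 
      rw [← mul_assoc, h5]
      exact h1
    obtain ⟨c', hc'⟩ := ih hsub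
    refine ⟨Function.update c' m c, ?_⟩
    filter_upwards [hc'] with t ht
    rw [Finset.sum_range_succ, Function.update_self, Finset.sum_congr rfl fun i hi => by
      rw [Function.update_of_ne (Finset.mem_range.1 hi).ne], ← ht]
    simp

/-- Taylor's formula with remainder for weakly differentiable functions. -/
lemma exists_taylor [CompleteSpace X] (hab : a < b) {s : ℕ} (hg : IntegrableOn g (Ioo a b))
    (h : IsWeakDeriv s (Ioo a b) f g) :
    ∃ c : ℕ → X, f =ᵐ[volume.restrict (Ioo a b)]
      fun t => ∑ i ∈ Finset.range s, t ^ i • c i + iterPrim a g s t := by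
  -- Subtracting the `s`-fold primitive of `g` leaves a function with vanishing `s`-th weak
  -- derivative.
  have h1 := h.sub (isWeakDeriv_iterPrim hg le_rfl (s := s))
  rw [Nat.sub_self, iterPrim, sub_self] at h1
  obtain ⟨c, hc⟩ := ae_eq_polynomial_of_isWeakDeriv_zero hab s h1
  refine ⟨c, ?_⟩
  filter_upwards [hc] with t ht
  rw [← ht]
  simp

end Prim

/-! ### Polynomials on the reference interval -/

/-- The Bernstein polynomials of order `k` span the polynomials of degree at most `k`. -/
lemma exists_eq_sum_bernstein {k : ℕ} {q : ℝ[X]} (hq : q.natDegree ≤ k) :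
    ∃ c : ℕ → ℝ, q = ∑ j ∈ Finset.range (k + 1), c j • bernsteinPolynomial ℝ k j := by
  have hdeg : ∀ j : Fin (k + 1), bernsteinPolynomial ℝ k j ∈ Polynomial.degreeLT ℝ (k + 1) := by
    intro j
    have hc : (j : ℕ) ≤ k := by omega
    rw [Polynomial.mem_degreeLT]
    refine lt_of_le_of_lt Polynomial.degree_le_natDegree ?_
    have : (bernsteinPolynomial ℝ k j).natDegree ≤ k := by
      simp only [bernsteinPolynomial]
      calc _ ≤ 0 + (j : ℕ) + (k - j) := by
            refine Polynomial.natDegree_mul_le_of_le (Polynomial.natDegree_mul_le_of_le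
              (by simp) (by simp)) ?_
            refine (Polynomial.natDegree_pow_le_of_le (m := 1) _ ?_).trans (by simp)
            exact (Polynomial.natDegree_sub_le _ _).trans (by simp)
        _ ≤ k := by omega
    exact_mod_cast Nat.lt_succ_of_le this
  -- These are `k + 1` independent vectors in a space of dimension `k + 1`, hence they span it.
  let B : Fin (k + 1) → Polynomial.degreeLT ℝ (k + 1) := fun j => ⟨_, hdeg j⟩
  have hB : LinearIndependent ℝ B := by
    rw [Fintype.linearIndependent_iff]
    intro c hc j
    have h := congrArg (Polynomial.degreeLT ℝ (k + 1)).subtype hc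
    simp only [map_sum, map_smul, map_zero, Submodule.subtype_apply, B] at h
    exact congrFun (bernstein_indep k c h) j
  have hfin : Fintype.card (Fin (k + 1)) = Module.finrank ℝ (Polynomial.degreeLT ℝ (k + 1)) := by
    rw [(Polynomial.degreeLTEquiv ℝ (k + 1)).finrank_eq]
    simp
  have : Module.Finite ℝ (Polynomial.degreeLT ℝ (k + 1)) :=
    Module.Finite.equiv (Polynomial.degreeLTEquiv ℝ (k + 1)).symm
  have hspan := hB.span_eq_top_of_card_eq_finrank' hfin
  have hqm : q ∈ Polynomial.degreeLT ℝ (k + 1) := by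
    rw [Polynomial.mem_degreeLT]
    exact lt_of_le_of_lt Polynomial.degree_le_natDegree (by exact_mod_cast Nat.lt_succ_of_le hq)
  have hmem : (⟨q, hqm⟩ : Polynomial.degreeLT ℝ (k + 1)) ∈ Submodule.span ℝ (range B) := by
    rw [hspan]; trivial
  obtain ⟨c, hc⟩ := (Submodule.mem_span_range_iff_exists_fun ℝ).1 hmem
  refine ⟨fun j => if h : j < k + 1 then c ⟨j, h⟩ else 0, ?_⟩
  have h := congrArg (Polynomial.degreeLT ℝ (k + 1)).subtype hc
  simp only [map_sum, map_smul, Submodule.subtype_apply, B] at h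
  rw [← h, Finset.sum_range]
  exact Finset.sum_congr rfl fun j _ => by
    dsimp only
    rw [dif_pos j.2]

lemma ip_localDual_sum {k i : ℕ} (hi : i ≤ k) (c : ℕ → ℝ) :
    ip (localDual k i) (∑ j ∈ Finset.range (k + 1), c j • bernsteinPolynomial ℝ k j) = c i := by
  rw [← ipL_apply, map_sum, Finset.sum_congr rfl (g := fun j => if i = j then c j else 0)]
  · rw [Finset.sum_ite_eq, if_pos (Finset.mem_range.2 (by omega))]
  · intro j hj
    rw [map_smul, ipL_apply, (localDual_spec k).2 i hi j (by simpa [Nat.lt_succ_iff] using hj)]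
    simp

lemma exists_polynomial_bound {ι : Type*} (s : Finset ι) (p : ι → ℝ[X]) :
    ∃ c : ℝ, 0 ≤ c ∧ ∀ i ∈ s, ∀ x ∈ Icc (0 : ℝ) 1, |(p i).eval x| ≤ c := by
  have h : ∀ i, ∃ c : ℝ, ∀ x ∈ Icc (0 : ℝ) 1, |(p i).eval x| ≤ c := fun i =>
    isCompact_Icc.exists_bound_of_continuousOn (p i).continuous.continuousOn
  choose c hc using h
  have h0 : ∀ i, 0 ≤ c i := fun i => (abs_nonneg _).trans (hc i 0 (by simp))
  exact ⟨∑ i ∈ s, c i, Finset.sum_nonneg fun i _ => h0 i, fun i hi x hx =>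
    (hc i x hx).trans (Finset.single_le_sum (fun j _ => h0 j) hi)⟩

lemma iteratedDeriv_eval_affine (p : ℝ[X]) (a h : ℝ) (m : ℕ) :
    iteratedDeriv m (fun t => p.eval ((t - a) / h)) =
      fun t => h⁻¹ ^ m * (Polynomial.derivative^[m] p).eval ((t - a) / h) := by
  induction m with
  | zero => ext; simp
  | succ m ih =>
    rw [iteratedDeriv_succ, ih]
    ext t
    have h1 : HasDerivAt (fun t => (t - a) / h) (1 / h) t :=
      ((hasDerivAt_id t).sub_const a).div_const h
    have h2 := (((Polynomial.derivative^[m] p).hasDerivAt ((t - a) / h)).comp t h1).const_mul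
      (h⁻¹ ^ m)
    refine h2.deriv.trans ?_
    rw [Function.iterate_succ_apply', pow_succ]
    ring

namespace TimeMesh

variable {T : ℝ} (M : TimeMesh T)

/-! ### Geometry of the partition -/

lemma node_lt_node {i j : ℕ} (hij : i < j) (hj : j ≤ M.N) : M.node i < M.node j := by
  induction j, hij using Nat.le_induction with
  | base => exact M.node_lt i (by omega)
  | succ j _ ih => exact (ih (by omega)).trans (M.node_lt j (by omega))

lemma node_mono {i j : ℕ} (hij : i ≤ j) (hj : j ≤ M.N) : M.node i ≤ M.node j := by
  rcases hij.eq_or_lt with rfl | h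
  · exact le_rfl
  · exact (M.node_lt_node h hj).le

lemma h_pos {n : ℕ} (hn : n < M.N) : 0 < M.h n := sub_pos.2 (M.node_lt n hn)

/-- The open interval with number `n`. -/
def openK (n : ℕ) : Set ℝ := Ioo (M.node n) (M.node (n + 1))

/-- Left end point of the element patch. -/
def left (n : ℕ) : ℝ := M.node (n - 1)

/-- Right end point of the element patch. -/
def right (n : ℕ) : ℝ := M.node (min (n + 2) M.N)

variable {n : ℕ}

lemma left_le (hn : n < M.N) : M.left n ≤ M.node n := M.node_mono (by omega) (by omega)

lemma le_right (hn : n < M.N) : M.node (n + 1) ≤ M.right n := M.node_mono (by omega) (by omega)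

lemma left_lt_right (hn : n < M.N) : M.left n < M.right n :=
  (M.left_le hn).trans_lt ((M.node_lt n hn).trans_le (M.le_right hn))

lemma zero_le_left (hn : n < M.N) : 0 ≤ M.left n := by
  rw [← M.node_zero]; exact M.node_mono (by omega) (by omega)

lemma right_le : M.right n ≤ T :=
  (M.node_mono (by omega) le_rfl).trans_eq M.node_last

lemma openK_subset (hn : n < M.N) {n' : ℕ} (h1 : n ≤ n' + 1) (h2 : n' ≤ n + 1) (h3 : n' < M.N) :
    M.openK n' ⊆ Ioo (M.left n) (M.right n) :=
  Ioo_subset_Ioo (M.node_mono (by omega) (by omega)) (M.node_mono (by omega) (by omega))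

lemma openK_subset_Ioo (hn : n < M.N) : M.openK n ⊆ Ioo 0 T :=
  (M.openK_subset hn (by omega) (by omega) hn).trans
    (Ioo_subset_Ioo (M.zero_le_left hn) M.right_le)

/-- Only the intervals with numbers `n - 1`, `n`, `n + 1` can meet `K n`. At the ends of the mesh,
truncated subtraction in `left` and the minimum in `right` account for the missing neighbour. -/
lemma patch_eq (hn : n < M.N) : M.patch n = Icc (M.left n) (M.right n) := by
  have hK : ∀ {i}, i < M.N → (M.node i ∈ M.K i ∧ M.node (i + 1) ∈ M.K i) := fun hi =>
    ⟨⟨le_rfl, (M.node_lt _ hi).le⟩, ⟨(M.node_lt _ hi).le, le_rfl⟩⟩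
  ext t
  simp only [patch, mem_ofPred_eq, mem_iUnion, exists_prop]
  constructor
  · rintro ⟨n', ⟨hn', x, hx, hx'⟩, ht⟩
    have h1 : n ≤ n' + 1 := by
      by_contra hc
      have := M.node_lt_node (i := n' + 1) (j := n) (by omega) (by omega)
      linarith [hx.1, hx'.2]
    have h2 : n' ≤ n + 1 := by
      by_contra hc
      have := M.node_lt_node (i := n + 1) (j := n') (by omega) (by omega)
      linarith [hx'.1, hx.2]
    exact ⟨(M.node_mono (by omega) (by omega)).trans ht.1,
      ht.2.trans (M.node_mono (by omega) (by omega))⟩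
  · rintro ⟨h1, h2⟩
    rcases le_or_gt t (M.node n) with ht | ht
    · rcases Nat.eq_zero_or_pos n with rfl | hpos
      · exact ⟨0, ⟨hn, _, (hK hn).1, (hK hn).1⟩, h1, ht.trans (M.node_lt 0 hn).le⟩
      · obtain ⟨l, rfl⟩ : ∃ l, n = l + 1 := ⟨n - 1, by omega⟩
        exact ⟨l, ⟨by omega, _, (hK hn).1, (hK (by omega)).2⟩, h1, ht⟩
    rcases le_or_gt t (M.node (n + 1)) with ht' | ht'
    · exact ⟨n, ⟨hn, _, (hK hn).1, (hK hn).1⟩, ht.le, ht'⟩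
    · rcases lt_or_ge (n + 1) M.N with hN | hN
      · refine ⟨n + 1, ⟨hN, _, (hK hn).2, (hK hN).1⟩, ht'.le, ?_⟩
        rwa [right, min_eq_left (by omega)] at h2
      · rw [right, min_eq_right (by omega)] at h2
        have : n + 1 = M.N := by omega
        rw [this] at ht'
        linarith

lemma h_le (hn : n < M.N) : M.h n ≤ M.right n - M.left n := by
  have := M.left_le hn
  have := M.le_right hn
  unfold h
  linarith

lemma right_sub_left_le {κ : ℝ} (hM : M.ShapeRegular κ) (hn : n < M.N) :
    M.right n - M.left n ≤ κ * M.h n := by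
  have := hM n hn
  rwa [M.patch_eq hn, Real.volume_real_Icc_of_le (M.left_lt_right hn).le] at this

lemma loc_mem (hn : n < M.N) {t : ℝ} (ht : t ∈ M.openK n) : M.loc n t ∈ Icc (0 : ℝ) 1 := by
  have := M.h_pos hn
  refine ⟨div_nonneg (by linarith [ht.1]) this.le, ?_⟩
  rw [loc, div_le_one this, h]
  linarith [ht.2]

/-- Combining the two index ranges gives `n * k ≤ (n' + 1) * k`, and `k ≥ 1` can be cancelled. This
is the source of all locality statements: intervals with a common node are neighbours. -/
lemma nodeMem_near {k i n n' : ℕ} (hk : 1 ≤ k) (h : nodeMem k i n) (h' : nodeMem k i n') :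
    n ≤ n' + 1 :=
  le_of_mul_le_mul_right (h.1.trans h'.2) hk

/-! ### The projection on one interval -/

lemma openK_subset_cell (n : ℕ) : M.openK n ⊆ M.cell n := by
  unfold cell openK
  split_ifs with h
  · subst h; exact Ioo_subset_Icc_self
  · exact Ioo_subset_Ioc_self

lemma cell_subset_K (n : ℕ) : M.cell n ⊆ M.K n := by
  unfold cell K
  split_ifs with h
  · subst h; exact subset_rfl
  · exact Ioc_subset_Icc_self

lemma measurableSet_cell (n : ℕ) : MeasurableSet (M.cell n) := by
  unfold cell
  split_ifs
  · exact measurableSet_Icc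
  · exact measurableSet_Ioc

/-- A point of the open interval lies in no other cell, so one summand survives. -/
lemma paste_of_mem (k : ℕ) (p : ℕ → ℝ[X]) (i : ℕ) (hn : n < M.N) {t : ℝ} (ht : t ∈ M.openK n)
    [Decidable (nodeMem k i n)] :
    M.paste k p i t = if nodeMem k i n then (p (i - n * k)).eval (M.loc n t) else 0 := by
  unfold paste
  rw [Finset.sum_eq_single n]
  · rw [indicator_of_mem (M.openK_subset_cell n ht)]
    congr
  · intro n' hn' hne
    rw [Finset.mem_range] at hn'
    rw [indicator_of_notMem, ite_self]
    intro hc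
    have hc := M.cell_subset_K n' hc
    rcases lt_or_gt_of_ne hne with hlt | hlt
    · have := M.node_mono (i := n' + 1) (j := n) (by omega) (by omega)
      linarith [hc.2, ht.1]
    · have := M.node_mono (i := n + 1) (j := n') (by omega) (by omega)
      linarith [hc.1, ht.2]
  · intro h; exact absurd (Finset.mem_range.2 hn) h

variable {X : Type*} [NormedAddCommGroup X] [NormedSpace ℝ X]

open Classical in
/-- The functional `v ↦ ∫ ψ i v`, written as a sum over the intervals that contain the node. -/
noncomputable def coef (k i : ℕ) (f : ℝ → X) : X :=
  (M.nodeLen k i)⁻¹ • ∑ n ∈ Finset.range M.N, if nodeMem k i n then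
    ∫ σ in M.openK n, (localDual k (i - n * k)).eval (M.loc n σ) • f σ else 0

lemma continuous_eval_loc (p : ℝ[X]) (n : ℕ) : Continuous fun t => p.eval (M.loc n t) := by
  unfold loc
  exact p.continuous.comp ((continuous_id.sub continuous_const).div_const _)

lemma integrableOn_eval_loc_smul (p : ℝ[X]) (n : ℕ) {S : Set ℝ} {a b : ℝ} (hS : MeasurableSet S)
    (hSab : S ⊆ Icc a b) {f : ℝ → X} (hf : IntegrableOn f S) :
    IntegrableOn (fun t => p.eval (M.loc n t) • f t) S := by
  obtain ⟨c, hc⟩ := isCompact_Icc.exists_bound_of_continuousOn (s := Icc a b)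
    (M.continuous_eval_loc p n).continuousOn
  exact Integrable.bdd_smul hf c (M.continuous_eval_loc p n).aestronglyMeasurable
    ((ae_restrict_iff' hS).2 (Filter.Eventually.of_forall fun t ht => hc t (hSab ht)))

lemma integrableOn_paste_term_smul (p : ℝ[X]) (n : ℕ) {f : ℝ → X} (hf : IntegrableOn f (Ioo 0 T)) :
    IntegrableOn (fun σ => (M.cell n).indicator (fun t => p.eval (M.loc n t)) σ • f σ)
      (Ioo 0 T) := by
  have h := (M.integrableOn_eval_loc_smul p n measurableSet_Ioo Ioo_subset_Icc_self hf).indicator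
    (M.measurableSet_cell n)
  refine h.congr (Filter.Eventually.of_forall fun σ => ?_)
  by_cases hσ : σ ∈ M.cell n <;> simp [hσ]

lemma integrableOn_psi_smul (k i : ℕ) {f : ℝ → X} (hf : IntegrableOn f (Ioo 0 T)) :
    IntegrableOn (fun σ => M.psi k i σ • f σ) (Ioo 0 T) := by
  classical
  simp only [psi, paste, mul_smul, Finset.sum_smul]
  refine Integrable.fun_smul _ (integrable_finsetSum _ fun n _ => ?_)
  split_ifs
  · exact M.integrableOn_paste_term_smul _ n hf
  · simp

lemma integral_psi_smul (k i : ℕ) {f : ℝ → X} (hf : IntegrableOn f (Ioo 0 T)) :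
    ∫ σ in Ioo 0 T, M.psi k i σ • f σ = M.coef k i f := by
  classical
  simp only [psi, coef, paste, mul_smul, Finset.sum_smul]
  rw [integral_smul, integral_finsetSum]
  · congr 1
    refine Finset.sum_congr rfl fun n hn => ?_
    rw [Finset.mem_range] at hn
    split_ifs with hi
    · have e : ∀ σ, (M.cell n).indicator (fun t => (localDual k (i - n * k)).eval (M.loc n t)) σ • f σ
          = (M.cell n).indicator
            (fun t => (localDual k (i - n * k)).eval (M.loc n t) • f t) σ := fun σ => by
        by_cases hσ : σ ∈ M.cell n <;> simp [hσ]
      simp only [e]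
      rw [setIntegral_indicator (M.measurableSet_cell n)]
      -- The part of the cell in `(0, T)` and the open interval differ at most by end points, a null
      -- set.
      refine setIntegral_congr_set (Filter.EventuallyLE.antisymm ?_ ?_)
      · refine (LE.le.eventuallyLE (inter_subset_right.trans (M.cell_subset_K n))).trans ?_
        exact Ioo_ae_eq_Icc.symm.le
      · exact LE.le.eventuallyLE (subset_inter (M.openK_subset_Ioo hn) (M.openK_subset_cell n))
    · simp
  · intro n _
    split_ifs
    · exact M.integrableOn_paste_term_smul _ n hf
    · simp

/-- Only the nodes of this interval contribute, and they are `n * k + j` with `j ≤ k`. -/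
lemma proj_of_mem (k : ℕ) {f : ℝ → X} (hf : IntegrableOn f (Ioo 0 T)) (hn : n < M.N) {t : ℝ}
    (ht : t ∈ M.openK n) :
    M.proj k f t = ∑ j ∈ Finset.range (k + 1),
      (bernsteinPolynomial ℝ k j).eval (M.loc n t) • M.coef k (n * k + j) f := by
  classical
  simp only [proj, M.integral_psi_smul k _ hf, bern, M.paste_of_mem k _ _ hn ht, ite_smul,
    zero_smul]
  rw [← Finset.sum_filter]
  have hle : (n + 1) * k ≤ M.N * k := Nat.mul_le_mul_right k hn
  symm
  refine Finset.sum_bij (fun j _ => n * k + j) ?_ ?_ ?_ ?_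
  · intro j hj
    rw [Finset.mem_range] at hj
    have : (n + 1) * k = n * k + k := by ring
    exact Finset.mem_filter.2 ⟨Finset.mem_range.2 (by omega), by omega, by omega⟩
  · intro i _ j _ h
    exact Nat.add_left_cancel h
  · intro i hi
    have : (n + 1) * k = n * k + k := by ring
    obtain ⟨-, h1, h2⟩ := Finset.mem_filter.1 hi
    exact ⟨i - n * k, Finset.mem_range.2 (by omega), by omega⟩
  · intro j _
    simp

/-! ### Locality, stability and polynomial reproduction -/

lemma h_le_nodeLen {k i : ℕ} (hn : n < M.N) (hi : nodeMem k i n) : M.h n ≤ M.nodeLen k i := by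
  classical
  unfold nodeLen
  have := Finset.single_le_sum (f := fun n => if nodeMem k i n then M.h n else 0)
    (s := Finset.range M.N) (fun n' hn' => by
      split_ifs
      · exact (M.h_pos (Finset.mem_range.1 hn')).le
      · exact le_rfl) (Finset.mem_range.2 hn)
  rw [if_pos hi] at this
  convert this

/-- Locality: every interval containing a node of `K n` lies in the patch of `K n`. -/
lemma coef_congr {k i : ℕ} (hk : 1 ≤ k) (hn : n < M.N) (hi : nodeMem k i n) {f f' : ℝ → X}
    (h : f =ᵐ[volume.restrict (Ioo (M.left n) (M.right n))] f') :
    M.coef k i f = M.coef k i f' := by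
  classical
  unfold coef
  congr 1
  refine Finset.sum_congr rfl fun n' hn' => ?_
  split_ifs with hi'
  · refine integral_congr_ae ?_
    filter_upwards [ae_restrict_of_ae_restrict_of_subset (M.openK_subset hn
      (nodeMem_near hk hi hi') (nodeMem_near hk hi' hi) (Finset.mem_range.1 hn')) h] with t ht
    rw [ht]
  · rfl

lemma coef_add {k i : ℕ} (hk : 1 ≤ k) (hn : n < M.N) (hi : nodeMem k i n) {f f' : ℝ → X}
    (h : IntegrableOn f (Ioo (M.left n) (M.right n)))
    (h' : IntegrableOn f' (Ioo (M.left n) (M.right n))) :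
    M.coef k i (fun t => f t + f' t) = M.coef k i f + M.coef k i f' := by
  classical
  unfold coef
  rw [← smul_add, ← Finset.sum_add_distrib]
  congr 1
  refine Finset.sum_congr rfl fun n' hn' => ?_
  split_ifs with hi'
  · have hs := M.openK_subset hn (nodeMem_near hk hi hi') (nodeMem_near hk hi' hi)
      (Finset.mem_range.1 hn')
    simp only [smul_add]
    exact integral_add
      (M.integrableOn_eval_loc_smul _ n' measurableSet_Ioo Ioo_subset_Icc_self (h.mono_set hs))
      (M.integrableOn_eval_loc_smul _ n' measurableSet_Ioo Ioo_subset_Icc_self (h'.mono_set hs))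
  · simp

/-- The factor `nodeLen⁻¹` is at most `h⁻¹`, the weights are bounded by `c`, and at most three
intervals are involved, each inside the patch. -/
lemma norm_coef_le {k i : ℕ} (hk : 1 ≤ k) (hn : n < M.N) (hi : nodeMem k i n) {f : ℝ → X}
    (h : IntegrableOn f (Ioo (M.left n) (M.right n))) {c : ℝ} (hc0 : 0 ≤ c)
    (hc : ∀ j ∈ Finset.range (k + 1), ∀ x ∈ Icc (0 : ℝ) 1, |(localDual k j).eval x| ≤ c) :
    ‖M.coef k i f‖ ≤ 3 * c / M.h n * ∫ t in Ioo (M.left n) (M.right n), ‖f t‖ := by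
  classical
  have hpos := M.h_pos hn
  set I := ∫ t in Ioo (M.left n) (M.right n), ‖f t‖ with hI
  have hI0 : 0 ≤ I := integral_nonneg fun _ => norm_nonneg _
  have hterm : ∀ n' ∈ Finset.range M.N, nodeMem k i n' →
      ‖∫ σ in M.openK n', (localDual k (i - n' * k)).eval (M.loc n' σ) • f σ‖ ≤ c * I := by
    intro n' hn' hi'
    have hn'' := Finset.mem_range.1 hn'
    have hs := M.openK_subset hn (nodeMem_near hk hi hi') (nodeMem_near hk hi' hi) hn''
    have hj : i - n' * k ∈ Finset.range (k + 1) := by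
      have := hi'.2
      have e : (n' + 1) * k = n' * k + k := by ring
      exact Finset.mem_range.2 (by omega)
    calc _ ≤ ∫ σ in M.openK n', c * ‖f σ‖ := by
          refine norm_integral_le_of_norm_le ((h.mono_set hs).norm.const_mul c) ?_
          refine (ae_restrict_iff' measurableSet_Ioo).2 (Filter.Eventually.of_forall fun t ht => ?_)
          rw [norm_smul, Real.norm_eq_abs]
          gcongr
          exact hc _ hj _ (M.loc_mem hn'' ht)
      _ = c * ∫ σ in M.openK n', ‖f σ‖ := integral_const_mul _ _
      _ ≤ c * I := by
          gcongr
          exact setIntegral_mono_set h.norm (Filter.Eventually.of_forall fun _ => norm_nonneg _)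
            (LE.le.eventuallyLE hs)
  have hsum : ‖∑ n ∈ Finset.range M.N, if nodeMem k i n then
      ∫ σ in M.openK n, (localDual k (i - n * k)).eval (M.loc n σ) • f σ else 0‖ ≤ 3 * (c * I) := by
    rw [← Finset.sum_filter]
    refine (norm_sum_le_of_le _ (n := fun _ => c * I) fun n' hn' => ?_).trans ?_
    · rw [Finset.mem_filter] at hn'
      exact hterm n' hn'.1 hn'.2
    · rw [Finset.sum_const, nsmul_eq_mul]
      refine mul_le_mul_of_nonneg_right ?_ (by positivity)
      have hsub : (Finset.range M.N).filter (nodeMem k i) ⊆ Finset.Icc (n - 1) (n + 1) := by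
        intro n' hn'
        have hi' := (Finset.mem_filter.1 hn').2
        have h1 := nodeMem_near hk hi hi'
        have h2 := nodeMem_near hk hi' hi
        exact Finset.mem_Icc.2 (by omega)
      have hcard := Finset.card_le_card hsub
      rw [Nat.card_Icc] at hcard
      exact_mod_cast hcard.trans (by omega)
  unfold coef
  rw [norm_smul, norm_inv, Real.norm_of_nonneg (hpos.le.trans (M.h_le_nodeLen hn hi))]
  calc _ ≤ (M.h n)⁻¹ * (3 * (c * I)) := by
        have := M.h_le_nodeLen hn hi
        gcongr
    _ = _ := by rw [div_eq_mul_inv]; ring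

/-- The coefficients of the projection of a polynomial are its Bernstein coefficients. -/
lemma sum_bernstein_smul_coef [CompleteSpace X] {k : ℕ} (hk : 1 ≤ k) (hn : n < M.N) {q : ℝ[X]}
    (hq : q.natDegree ≤ k) (x : X) (t : ℝ) :
    ∑ j ∈ Finset.range (k + 1), (bernsteinPolynomial ℝ k j).eval (M.loc n t) •
      M.coef k (n * k + j) (fun t => q.eval t • x) = q.eval t • x := by
  classical
  -- This is `q` in the local coordinate of interval `n'`; its Bernstein coefficients `c n' j` are
  -- what the projection must return.
  let r : ℕ → ℝ[X] := fun n' =>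
    q.comp (Polynomial.C (M.node n') + Polynomial.C (M.h n') * Polynomial.X)
  have hr : ∀ n', (r n').natDegree ≤ k := fun n' => by
    refine Polynomial.natDegree_comp_le.trans ?_
    have : (Polynomial.C (M.node n') + Polynomial.C (M.h n') * Polynomial.X).natDegree ≤ 1 := by
      rw [add_comm]; exact Polynomial.natDegree_linear_le
    calc _ ≤ q.natDegree * 1 := Nat.mul_le_mul_left _ this
      _ ≤ k := by simpa using hq
  choose c hc using fun n' => exists_eq_sum_bernstein (hr n')
  have hrloc : ∀ n' < M.N, ∀ t, (r n').eval (M.loc n' t) = q.eval t := by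
    intro n' hn' t
    have := (M.h_pos hn').ne'
    simp only [r, Polynomial.eval_comp, Polynomial.eval_add, Polynomial.eval_C,
      Polynomial.eval_mul, Polynomial.eval_X, loc]
    congr 1
    field_simp
    ring
  have heval : ∀ n' y, (r n').eval y
      = ∑ j ∈ Finset.range (k + 1), c n' j * (bernsteinPolynomial ℝ k j).eval y := by
    intro n' y
    conv_lhs => rw [hc n']
    simp [Polynomial.eval_finsetSum]
  -- the coefficients of neighbours agree in the common node
  have hnext : ∀ n', n' + 1 < M.N → c n' k = c (n' + 1) 0 := by
    intro n' hn'
    have h1 := heval n' 1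
    have h0 := heval (n' + 1) 0
    simp only [bernsteinPolynomial.eval_at_1, bernsteinPolynomial.eval_at_0, mul_ite, mul_one,
      mul_zero, Finset.sum_ite_eq', Finset.mem_range] at h0 h1
    rw [if_pos (by omega)] at h0 h1
    rw [← h0, ← h1]
    simp [r, h]
  have hcomm : ∀ i, nodeMem k i n → ∀ n' < M.N, nodeMem k i n' → c n' (i - n' * k) = c n (i - n * k) := by
    intro i hi n' hn' hi'
    have h1 := nodeMem_near hk hi hi'
    have h2 := nodeMem_near hk hi' hi
    obtain h | h | h : n' = n ∨ n = n' + 1 ∨ n' = n + 1 := by omega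
    · rw [h]
    · subst h
      have : i = n' * k + k := le_antisymm (by linarith [hi'.2]) (by linarith [hi.1])
      rw [show i - n' * k = k by omega, show i - (n' + 1) * k = 0 by rw [add_mul]; omega]
      exact hnext n' hn
    · subst h
      have : i = n * k + k := le_antisymm (by linarith [hi.2]) (by linarith [hi'.1])
      rw [show i - n * k = k by omega, show i - (n + 1) * k = 0 by rw [add_mul]; omega]
      exact (hnext n hn').symm
  -- The change to the local coordinate contributes the length of the interval, and biorthogonality
  -- extracts the coefficient.
  have hint : ∀ n' < M.N, ∀ j ≤ k,
      ∫ σ in M.openK n', (localDual k j).eval (M.loc n' σ) • q.eval σ • x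
        = (M.h n' * c n' j) • x := by
    intro n' hn' j hj
    have hpos := M.h_pos hn'
    simp only [smul_smul]
    rw [integral_smul_const]
    congr 1
    have e : ∀ σ, (localDual k j).eval (M.loc n' σ) * q.eval σ
        = (fun y => (localDual k j).eval y * (r n').eval y) (σ / M.h n' - M.node n' / M.h n') := by
      intro σ
      rw [← hrloc n' hn' σ]
      simp [loc, sub_div]
    rw [integral_congr_ae (Filter.Eventually.of_forall e), openK, ← integral_Ioc_eq_integral_Ioo,
      ← intervalIntegral.integral_of_le (M.node_lt n' hn').le,
      intervalIntegral.integral_comp_div_sub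
        (fun y => (localDual k j).eval y * (r n').eval y) hpos.ne', sub_self,
      show M.node (n' + 1) / M.h n' - M.node n' / M.h n' = 1 by
        rw [← sub_div]; exact div_self hpos.ne']
    have := ip_localDual_sum hj (c n')
    rw [← hc n'] at this
    rw [← this]
    rfl
  have hcoef : ∀ j ∈ Finset.range (k + 1),
      M.coef k (n * k + j) (fun t => q.eval t • x) = c n j • x := by
    intro j hj
    rw [Finset.mem_range] at hj
    have hi : nodeMem k (n * k + j) n := ⟨by omega, by rw [add_mul]; omega⟩
    have hlen : 0 < M.nodeLen k (n * k + j) := (M.h_pos hn).trans_le (M.h_le_nodeLen hn hi)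
    unfold coef
    -- All intervals at the node carry the same coefficient, so it factors out; the remaining sum of
    -- lengths is `nodeLen`, which cancels the normalisation of `psi`.
    rw [Finset.sum_congr rfl (g := fun n' =>
      (if nodeMem k (n * k + j) n' then M.h n' else 0) • (c n j • x))]
    · rw [← Finset.sum_smul, smul_smul]
      have : ∑ n' ∈ Finset.range M.N, (if nodeMem k (n * k + j) n' then M.h n' else 0)
          = M.nodeLen k (n * k + j) := by unfold nodeLen; congr
      rw [this, inv_mul_cancel₀ hlen.ne', one_smul]
    · intro n' hn'
      rw [Finset.mem_range] at hn'
      split_ifs with hi'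
      · have hj' : n * k + j - n' * k ≤ k := by
          have := hi'.2
          rw [add_mul] at this
          omega
        rw [hint n' hn' _ hj', hcomm _ hi n' hn' hi', mul_smul, Nat.add_sub_cancel_left]
      · simp
  rw [Finset.sum_congr rfl fun j hj => by rw [hcoef j hj, smul_smul], ← Finset.sum_smul,
    ← hrloc n hn t, heval]
  simp only [mul_comm]

lemma interior_K : interior (M.K n) = M.openK n := interior_Icc

/-! ### The interpolation estimate for functions with values in a Banach space -/

/-- The projection reproduces polynomials with vector coefficients. -/
lemma sum_bernstein_smul_coef_sum [CompleteSpace X] {k : ℕ} (hk : 1 ≤ k) (hn : n < M.N) {s : ℕ}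
    (hs : s ≤ k + 1) (x : ℕ → X) (t : ℝ) :
    ∑ j ∈ Finset.range (k + 1), (bernsteinPolynomial ℝ k j).eval (M.loc n t) •
      M.coef k (n * k + j) (fun t => ∑ i ∈ Finset.range s, t ^ i • x i)
        = ∑ i ∈ Finset.range s, t ^ i • x i := by
  induction s with
  | zero => simp [coef]
  | succ s ih =>
    have hint : ∀ {F : ℝ → X}, Continuous F → IntegrableOn F (Ioo (M.left n) (M.right n)) :=
      fun hF => (hF.continuousOn.integrableOn_compact isCompact_Icc).mono_set Ioo_subset_Icc_self
    have h1 := M.sum_bernstein_smul_coef hk hn (q := Polynomial.X ^ s)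
      (by rw [Polynomial.natDegree_X_pow]; omega) (x s) t
    simp only [Polynomial.eval_pow, Polynomial.eval_X] at h1
    simp only [Finset.sum_range_succ _ s]
    rw [← h1, ← ih (by omega), ← Finset.sum_add_distrib]
    refine Finset.sum_congr rfl fun j hj => ?_
    rw [Finset.mem_range] at hj
    rw [M.coef_add hk hn ⟨by omega, by rw [add_mul]; omega⟩ (hint (by fun_prop))
      (hint (by fun_prop)), smul_add]

/-- The Taylor polynomial is reproduced and cancels, so the error of `f` equals the error of its
remainder `iterPrim (M.left n) g s`, whose derivatives are explicit. -/
lemma isWeakDeriv_sub_proj [CompleteSpace X] {k : ℕ} (hk : 1 ≤ k) (hn : n < M.N) {m s : ℕ}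
    (hms : m ≤ s) (hs : s ≤ k + 1) {f g : ℝ → X} (hf : IntegrableOn f (Ioo 0 T))
    (hg : IntegrableOn g (Ioo (M.left n) (M.right n)))
    (h : IsWeakDeriv s (Ioo (M.left n) (M.right n)) f g) :
    IsWeakDeriv m (M.openK n) (fun t => f t - M.proj k f t)
      (iterPrim (M.left n) g (s - m) - fun t => ∑ j ∈ Finset.range (k + 1),
        ((M.h n)⁻¹ ^ m * (Polynomial.derivative^[m] (bernsteinPolynomial ℝ k j)).eval (M.loc n t)) •
          M.coef k (n * k + j) (iterPrim (M.left n) g s)) := by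
  have hsub := M.openK_subset hn (by omega) (by omega) hn
  obtain ⟨c, hc⟩ := exists_taylor (M.left_lt_right hn) hg h
  have hpoly : ∀ j, IsWeakDeriv m (M.openK n)
      (fun t => (bernsteinPolynomial ℝ k j).eval (M.loc n t) •
        M.coef k (n * k + j) (iterPrim (M.left n) g s))
      (fun t => ((M.h n)⁻¹ ^ m *
        (Polynomial.derivative^[m] (bernsteinPolynomial ℝ k j)).eval (M.loc n t)) •
          M.coef k (n * k + j) (iterPrim (M.left n) g s)) := by
    intro j
    have hsm : ContDiff ℝ (⊤ : ℕ∞)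
        fun t => (bernsteinPolynomial ℝ k j).eval ((t - M.node n) / M.h n) := by
      have h1 : ContDiff ℝ (⊤ : ℕ∞) fun t => (t - M.node n) / M.h n := by fun_prop
      have h2 : ContDiff ℝ (⊤ : ℕ∞) fun t => (bernsteinPolynomial ℝ k j).eval t := by
        simpa [Polynomial.coe_aeval_eq_eval] using
          (bernsteinPolynomial ℝ k j).contDiff_aeval (𝕜 := ℝ) (⊤ : ℕ∞)
      exact h2.comp h1
    have := isWeakDeriv_smul_const (M.openK n)
      (ρ := fun t => (bernsteinPolynomial ℝ k j).eval ((t - M.node n) / M.h n))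
      hsm
      (M.coef k (n * k + j) (iterPrim (M.left n) g s)) m
    rw [iteratedDeriv_eval_affine] at this
    exact this
  refine (((isWeakDeriv_iterPrim hg hms).mono hsub).sub
    (IsWeakDeriv.sum (Finset.range (k + 1)) fun j _ => hpoly j)).congr ?_
  have hcoef : ∀ j ∈ Finset.range (k + 1), M.coef k (n * k + j) f
      = M.coef k (n * k + j) (fun t => ∑ i ∈ Finset.range s, t ^ i • c i)
        + M.coef k (n * k + j) (iterPrim (M.left n) g s) := by
    intro j hj
    rw [Finset.mem_range] at hj
    have hi : nodeMem k (n * k + j) n := ⟨by omega, by rw [add_mul]; omega⟩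
    have hcont : Continuous fun t : ℝ => ∑ i ∈ Finset.range s, t ^ i • c i := by fun_prop
    rw [M.coef_congr hk hn hi hc, M.coef_add hk hn hi
      ((hcont.continuousOn.integrableOn_compact isCompact_Icc).mono_set Ioo_subset_Icc_self)
      (integrableOn_iterPrim hg s)]
  filter_upwards [ae_restrict_of_ae_restrict_of_subset hsub hc,
    ae_restrict_mem measurableSet_Ioo] with t ht htK
  have hproj : M.proj k f t = ∑ i ∈ Finset.range s, t ^ i • c i + ∑ j ∈ Finset.range (k + 1),
      (bernsteinPolynomial ℝ k j).eval (M.loc n t) •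
        M.coef k (n * k + j) (iterPrim (M.left n) g s) := by
    rw [M.proj_of_mem k hf hn htK, ← M.sum_bernstein_smul_coef_sum hk hn hs c t,
      ← Finset.sum_add_distrib]
    exact Finset.sum_congr rfl fun j hj => by rw [hcoef j hj, smul_add]
  rw [hproj, ht, add_sub_add_left_eq_sub]
  rfl

/-- Counting powers of length: `h^(1/2)` from the `L²` norm of a bounded function, `h^(-m)` from the
derivatives, `h^(-1)` from the coefficients, `|patch|^(1/2)` from Cauchy's inequality and
`|patch|^s` from the primitives. With `|patch| ≤ κ h` the total is `κ^(s+1) h^(s-m)`. -/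
lemma eLpNorm_sum_derivative_smul_coef_le {k : ℕ} (hk : 1 ≤ k) (hn : n < M.N)
    {κ : ℝ} (hκ : M.right n - M.left n ≤ κ * M.h n)
    {cb cp : ℝ} (hcb0 : 0 ≤ cb) (hcp0 : 0 ≤ cp) {m s : ℕ} (hms : m ≤ s)
    (hcb : ∀ j ∈ Finset.range (k + 1), ∀ x ∈ Icc (0 : ℝ) 1,
      |(Polynomial.derivative^[m] (bernsteinPolynomial ℝ k j)).eval x| ≤ cb)
    (hcp : ∀ j ∈ Finset.range (k + 1), ∀ x ∈ Icc (0 : ℝ) 1, |(localDual k j).eval x| ≤ cp)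
    {g : ℝ → X} (hg : MemLp g 2 (volume.restrict (Ioo (M.left n) (M.right n)))) :
    eLpNorm (fun t => ∑ j ∈ Finset.range (k + 1),
        ((M.h n)⁻¹ ^ m * (Polynomial.derivative^[m] (bernsteinPolynomial ℝ k j)).eval (M.loc n t)) •
          M.coef k (n * k + j) (iterPrim (M.left n) g s)) 2 (volume.restrict (M.openK n)) ≤
      ENNReal.ofReal (3 * (k + 1) * cb * cp * κ ^ (s + 1) * M.h n ^ (s - m)) *
        eLpNorm g 2 (volume.restrict (Ioo (M.left n) (M.right n))) := by
  have hpos := M.h_pos hn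
  have hlr := M.left_lt_right hn
  set a := M.left n
  set b := M.right n
  set G := (eLpNorm g 2 (volume.restrict (Ioo a b))).toReal with hG
  have hba : 0 < b - a := sub_pos.2 hlr
  have hR := memLp_iterPrim hlr.le hg s
  have hRG : (eLpNorm (iterPrim a g s) 2 (volume.restrict (Ioo a b))).toReal ≤ (b - a) ^ s * G := by
    have := ENNReal.toReal_mono (ENNReal.mul_ne_top ENNReal.ofReal_ne_top hg.2.ne) hR.2
    rwa [ENNReal.toReal_mul, ENNReal.toReal_ofReal (by positivity)] at this
  set A := 3 * cp / M.h n * ((b - a) ^ (1 / 2 : ℝ) * ((b - a) ^ s * G)) with hA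
  have hcoef : ∀ j ∈ Finset.range (k + 1), ‖M.coef k (n * k + j) (iterPrim a g s)‖ ≤ A := by
    intro j hj
    rw [Finset.mem_range] at hj
    refine (M.norm_coef_le hk hn ⟨by omega, by rw [add_mul]; omega⟩
      (hR.1.integrable (by norm_num)) hcp0 hcp).trans ?_
    have := integral_norm_le_sqrt_mul_eLpNorm hlr.le hR.1
    rw [hA]
    gcongr
    exact this.trans (by gcongr)
  have hbound : ∀ t ∈ Ioo (M.node n) (M.node (n + 1)), ‖∑ j ∈ Finset.range (k + 1),
      ((M.h n)⁻¹ ^ m * (Polynomial.derivative^[m] (bernsteinPolynomial ℝ k j)).eval (M.loc n t)) •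
          M.coef k (n * k + j) (iterPrim a g s)‖ ≤ (k + 1) * ((M.h n)⁻¹ ^ m * cb * A) := by
    intro t ht
    refine (norm_sum_le_of_le _ (n := fun _ => (M.h n)⁻¹ ^ m * cb * A) fun j hj => ?_).trans
      (by simp)
    rw [norm_smul, norm_mul, Real.norm_of_nonneg (by positivity : 0 ≤ (M.h n)⁻¹ ^ m),
      Real.norm_eq_abs]
    gcongr
    · exact hcb j hj _ (M.loc_mem hn ht)
    · exact hcoef j hj
  refine (eLpNorm_two_le_of_bound (M.node_lt n hn).le hbound).trans ?_
  rw [← ENNReal.ofReal_toReal hg.2.ne, ← hG, ← ENNReal.ofReal_mul' ENNReal.toReal_nonneg]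
  apply ENNReal.ofReal_le_ofReal
  have hG0 : 0 ≤ G := ENNReal.toReal_nonneg
  have hh : (M.node (n + 1) - M.node n) ^ (1 / 2 : ℝ) ≤ (b - a) ^ (1 / 2 : ℝ) :=
    Real.rpow_le_rpow hpos.le (M.h_le hn) (by norm_num)
  have hsq : (b - a) ^ (1 / 2 : ℝ) * (b - a) ^ (1 / 2 : ℝ) = b - a := by
    rw [← Real.rpow_add hba]; norm_num
  calc (M.node (n + 1) - M.node n) ^ (1 / 2 : ℝ) * ((k + 1) * ((M.h n)⁻¹ ^ m * cb * A))
      ≤ (b - a) ^ (1 / 2 : ℝ) * ((k + 1) * ((M.h n)⁻¹ ^ m * cb * A)) := by gcongr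
    _ = 3 * (k + 1) * cb * cp * ((M.h n)⁻¹ ^ m * (M.h n)⁻¹ *
          ((b - a) ^ (1 / 2 : ℝ) * (b - a) ^ (1 / 2 : ℝ)) * (b - a) ^ s) * G := by
        rw [hA, div_eq_mul_inv]; ring
    _ = 3 * (k + 1) * cb * cp * ((M.h n)⁻¹ ^ m * (M.h n)⁻¹ * (b - a) ^ (s + 1)) * G := by
        rw [hsq]; ring
    _ ≤ 3 * (k + 1) * cb * cp * ((M.h n)⁻¹ ^ m * (M.h n)⁻¹ * (κ * M.h n) ^ (s + 1)) * G := by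
        gcongr
    _ = 3 * (k + 1) * cb * cp * κ ^ (s + 1) * M.h n ^ (s - m) * G := by
        have : M.h n ^ s = M.h n ^ (s - m) * M.h n ^ m := by rw [← pow_add]; congr 1; omega
        rw [mul_pow, pow_succ (M.h n) s, this, inv_pow]
        field_simp

end TimeMesh

/-! ### The uniform constant in the Banach-valued estimate -/

lemma eLpNorm_restrict_Icc {X : Type*} [NormedAddCommGroup X] (f : ℝ → X) (a b : ℝ) :
    eLpNorm f 2 (volume.restrict (Icc a b)) = eLpNorm f 2 (volume.restrict (Ioo a b)) := by
  rw [← restrict_Ioo_eq_restrict_Icc]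

/-- Interpolation in time for integrable functions with values in a Banach space. -/
theorem exists_derivNorm_sub_proj_le (k : ℕ) (hk : 1 ≤ k) (κ : ℝ) :
    ∃ C : ℝ≥0, ∀ (T : ℝ) (M : TimeMesh T) (_ : M.ShapeRegular κ) (X : Type)
      [NormedAddCommGroup X] [NormedSpace ℝ X] [CompleteSpace X] (f : ℝ → X)
      (_ : IntegrableOn f (Ioo 0 T)) (m s : ℕ) (_ : m ≤ s) (_ : s ≤ k + 1) (n : ℕ) (_ : n < M.N),
      derivNorm m (M.K n) (fun t => f t - M.proj k f t) ≤
        C * ENNReal.ofReal (M.h n ^ (s - m)) * derivNorm s (M.patch n) f := by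
  -- One bound for all derivatives of order `m ≤ s ≤ k + 1` makes the constant independent of `m`
  -- and `s`.
  obtain ⟨cb, hcb0, hcb⟩ := exists_polynomial_bound (Finset.range (k + 1) ×ˢ Finset.range (k + 2))
    fun jm => Polynomial.derivative^[jm.2] (bernsteinPolynomial ℝ k jm.1)
  obtain ⟨cp, hcp0, hcp⟩ := exists_polynomial_bound (Finset.range (k + 1)) (localDual k)
  -- With base at least one, the powers with exponents `s - m` and `s + 1` are both at most `κ' ^ (k
  -- + 2)`.
  set κ' := max κ 1 with hκ'
  have hκ1 : 1 ≤ κ' := le_max_right _ _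
  have hκ0 : 0 ≤ κ' := by linarith
  set c : ℝ := κ' ^ (k + 2) + 3 * (k + 1) * cb * cp * κ' ^ (k + 2) with hc
  have hcpos : 0 < c := by positivity
  refine ⟨c.toNNReal, fun T M hM X _ _ _ f hf m s hms hs n hn => ?_⟩
  have hpos := M.h_pos hn
  have hA : (c.toNNReal : ℝ≥0∞) * ENNReal.ofReal (M.h n ^ (s - m))
      = ENNReal.ofReal (c * M.h n ^ (s - m)) := by
    rw [ENNReal.ofReal_mul hcpos.le]; rfl
  -- A finite nonzero factor can be moved inside the infimum that defines `derivNorm`; it then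
  -- suffices to treat each weak derivative `g` on the patch.
  have hA0 : ENNReal.ofReal (c * M.h n ^ (s - m)) ≠ 0 := by
    rw [Ne, ENNReal.ofReal_eq_zero, not_le]; positivity
  have hκh : M.right n - M.left n ≤ κ' * M.h n :=
    (M.right_sub_left_le hM hn).trans (by gcongr; exact le_max_left _ _)
  rw [hA, M.patch_eq hn, derivNorm, derivNorm, interior_Icc, M.interior_K,
    ENNReal.mul_iInf_of_ne hA0 ENNReal.ofReal_ne_top]
  refine le_iInf fun g => ?_
  rw [ENNReal.mul_iInf_of_ne hA0 ENNReal.ofReal_ne_top]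
  refine le_iInf fun hg => ?_
  rw [eLpNorm_restrict_Icc]
  rcases eq_or_ne (eLpNorm g 2 (volume.restrict (Ioo (M.left n) (M.right n)))) ∞ with htop | htop
  · rw [htop, ENNReal.mul_top hA0]; exact le_top
  have hgm : MemLp g 2 (volume.restrict (Ioo (M.left n) (M.right n))) :=
    ⟨hg.2.1.aestronglyMeasurable, lt_top_iff_ne_top.2 htop⟩
  have hgi : IntegrableOn g (Ioo (M.left n) (M.right n)) := hgm.integrable (by norm_num)
  refine (iInf₂_le _ (M.isWeakDeriv_sub_proj hk hn hms hs hf hgi hg)).trans ?_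
  rw [TimeMesh.K, eLpNorm_restrict_Icc]
  have hsub := M.openK_subset hn (by omega) (by omega) hn
  have hR := memLp_iterPrim (M.left_lt_right hn).le hgm (s - m)
  refine (eLpNorm_sub_le (hR.1.1.mono_measure (Measure.restrict_mono hsub le_rfl)) ?_
    (by norm_num)).trans ?_
  · refine Continuous.aestronglyMeasurable (continuous_finsetSum _ fun j _ => ?_)
    exact (continuous_const.mul (M.continuous_eval_loc _ n)).smul continuous_const
  have h1 := (eLpNorm_mono_measure (iterPrim (M.left n) g (s - m)) (p := 2)
    (Measure.restrict_mono hsub le_rfl)).trans hR.2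
  have h2 := M.eLpNorm_sum_derivative_smul_coef_le hk hn hκh hcb0 hcp0 hms
    (fun j hj => hcb (j, m) (by simp at hj ⊢; omega)) hcp hgm
  refine (add_le_add h1 h2).trans ?_
  rw [← add_mul, ← ENNReal.ofReal_add (pow_nonneg (sub_nonneg.2 (M.left_lt_right hn).le) _)
    (by positivity)]
  gcongr
  have hp1 : (M.right n - M.left n) ^ (s - m) ≤ κ' ^ (k + 2) * M.h n ^ (s - m) := by
    calc _ ≤ (κ' * M.h n) ^ (s - m) :=
          pow_le_pow_left₀ (sub_nonneg.2 (M.left_lt_right hn).le) hκh _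
      _ = κ' ^ (s - m) * M.h n ^ (s - m) := mul_pow _ _ _
      _ ≤ _ := mul_le_mul_of_nonneg_right (pow_le_pow_right₀ hκ1 (by omega)) (by positivity)
  have hp2 : κ' ^ (s + 1) ≤ κ' ^ (k + 2) := pow_le_pow_right₀ hκ1 (by omega)
  calc _ ≤ κ' ^ (k + 2) * M.h n ^ (s - m)
        + 3 * (k + 1) * cb * cp * κ' ^ (k + 2) * M.h n ^ (s - m) := by gcongr
    _ = _ := by rw [hc]; ring

/-! ### Continuity of the embeddings in space -/

section Space

variable {d : ℕ}

lemma coeFn_restrictL2 {S Ω : Set (Euc d)} (h : S ⊆ Ω) (u : L2 Ω) :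
    restrictL2 h u =ᵐ[volume.restrict S] u := MemLp.coeFn_toLp _

/-- Restriction as a continuous linear map. -/
noncomputable def restrictL2CLM {S Ω : Set (Euc d)} (h : S ⊆ Ω) : L2 Ω →L[ℝ] L2 S :=
  LinearMap.mkContinuous
    { toFun := restrictL2 h
      map_add' := fun u w => by
        apply Lp.ext
        filter_upwards [coeFn_restrictL2 h (u + w), coeFn_restrictL2 h u, coeFn_restrictL2 h w,
          Lp.coeFn_add (restrictL2 h u) (restrictL2 h w),
          ae_restrict_of_ae_restrict_of_subset h (Lp.coeFn_add u w)] with x h1 h2 h3 h4 h5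
        rw [h1, h4, h5, Pi.add_apply, Pi.add_apply, h2, h3]
      map_smul' := fun c u => by
        apply Lp.ext
        filter_upwards [coeFn_restrictL2 h (c • u), coeFn_restrictL2 h u,
          Lp.coeFn_smul c (restrictL2 h u),
          ae_restrict_of_ae_restrict_of_subset h (Lp.coeFn_smul c u)] with x h1 h2 h3 h4
        rw [RingHom.id_apply, h1, h3, h4, Pi.smul_apply, Pi.smul_apply, h2] }
    1 fun u => by
      rw [one_mul]
      change ‖restrictL2 h u‖ ≤ ‖u‖
      rw [restrictL2, Lp.norm_toLp, Lp.norm_def]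
      exact ENNReal.toReal_mono (Lp.eLpNorm_ne_top u)
        (eLpNorm_mono_measure _ (Measure.restrict_mono h le_rfl))

lemma restrictL2CLM_apply {S Ω : Set (Euc d)} (h : S ⊆ Ω) (u : L2 Ω) :
    restrictL2CLM h u = restrictL2 h u := rfl

variable [NeZero d]

/-- The embedding of `L²(Ω)` into `W^{-1,2}(ω)` as a continuous linear map. -/
noncomputable def toWnegCLM {ω Ω : Set (Euc d)} (hω : Bornology.IsBounded ω) (h : ω ⊆ Ω) :
    L2 Ω →L[ℝ] Wneg ω :=
  LinearMap.mkContinuous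
    { toFun := toWneg hω h
      map_add' := fun u w => by
        ext z
        simp [toWneg, ← restrictL2CLM_apply]
      map_smul' := fun c u => by
        ext z
        simp [toWneg, ← restrictL2CLM_apply] }
    (‖W01.toL2CLM hω‖ * ‖restrictL2CLM h‖) fun u => by
      change ‖(innerSL ℝ (restrictL2CLM h u)).comp (W01.toL2CLM hω)‖ ≤ _
      refine (ContinuousLinearMap.opNorm_comp_le _ _).trans ?_
      rw [innerSL_apply_norm, mul_comm, mul_assoc]
      gcongr
      exact (restrictL2CLM h).le_opNorm u

instance {ω : Set (Euc d)} : CompleteSpace (Wneg ω) :=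
  inferInstanceAs (CompleteSpace (W01 ω →L[ℝ] ℝ))

/-- Friedrichs' inequality makes the embedding of `W01 Ω` into `L2 Ω` bounded, so `v` is square
integrable with values in `L2 Ω`, hence integrable on the bounded interval. -/
lemma integrableOn_of_mem_V {T : ℝ} {Ω : Set (Euc d)} {hΩ : Bornology.IsBounded Ω} {v : ℝ → L2 Ω}
    (hv : v ∈ V T hΩ) : IntegrableOn v (Ioo 0 T) := by
  obtain ⟨⟨w, hw, hvw⟩, -⟩ := hv
  have h1 : AEStronglyMeasurable (fun t => W01.toL2CLM hΩ (w t)) (volume.restrict (Ioo 0 T)) :=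
    (W01.toL2CLM hΩ).continuous.comp_aestronglyMeasurable hw.1
  have h2 : MemLp (fun t => W01.toL2CLM hΩ (w t)) 2 (volume.restrict (Ioo 0 T)) :=
    hw.of_le_mul' (c := ‖W01.toL2CLM hΩ‖₊) h1 (Filter.Eventually.of_forall fun t =>
      ENNReal.coe_le_coe.2 ((W01.toL2CLM hΩ).le_opNNNorm (w t)))
  have h3 : IntegrableOn (fun t => W01.toL2CLM hΩ (w t)) (Ioo 0 T) := h2.integrable (by norm_num)
  have hvw' : (fun t => W01.toL2CLM hΩ (w t)) =ᵐ[volume.restrict (Ioo 0 T)] v := by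
    filter_upwards [hvw] with t ht
    rw [ht]
    rfl
  exact h3.congr hvw'

end Space

/-- Bochner integrals commute with bounded linear maps; thus the projection may be computed in
`L²(Ω)` or in the target space. -/
lemma TimeMesh.map_proj {T : ℝ} (M : TimeMesh T) (k : ℕ) {X Y : Type*} [NormedAddCommGroup X]
    [NormedSpace ℝ X] [CompleteSpace X] [NormedAddCommGroup Y] [NormedSpace ℝ Y] [CompleteSpace Y]
    (L : X →L[ℝ] Y) {v : ℝ → X} (hv : IntegrableOn v (Ioo 0 T)) (t : ℝ) :
    L (M.proj k v t) = M.proj k (fun t => L (v t)) t := by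
  simp only [TimeMesh.proj, map_sum, map_smul]
  refine Finset.sum_congr rfl fun i _ => ?_
  rw [← L.integral_comp_comm (M.integrableOn_psi_smul k i hv)]
  simp only [map_smul]

end SpaceTime

/-! ### Transfer to the negative Sobolev spaces and to the simplices -/

theorem theorem4p2 (k : ℕ) (hk : 1 ≤ k) (κ : ℝ) :
    ∃ C : ℝ≥0, ∀ (T : ℝ) (_ : 0 < T) (M : SpaceTime.TimeMesh T) (_ : M.ShapeRegular κ)
      (d : ℕ) [NeZero d] (Ω : Set (SpaceTime.Euc d)) (_ : IsOpen Ω)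
      (hΩ : Bornology.IsBounded Ω) (v : ℝ → SpaceTime.L2 Ω) (_ : v ∈ SpaceTime.V T hΩ)
      (m s : ℕ) (_ : m ≤ s) (_ : s ≤ k + 1) (n : ℕ) (_ : n < M.N),
      (∀ (ω : Set (SpaceTime.Euc d)) (_ : IsOpen ω) (hω : ω ⊆ Ω),
        SpaceTime.derivNorm m (M.K n)
            (fun t => SpaceTime.toWneg (hΩ.subset hω) hω (v t - M.proj k v t)) ≤
          C * ENNReal.ofReal (M.h n ^ (s - m)) *
            SpaceTime.derivNorm s (M.patch n)
              (fun t => SpaceTime.toWneg (hΩ.subset hω) hω (v t))) ∧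
      (∀ (S : Geometry.SimplicialComplex ℝ (SpaceTime.Euc d)) (_ : SpaceTime.IsTriangulation S Ω),
        ∀ K ∈ SpaceTime.simplices S,
        SpaceTime.derivNorm m (M.K n)
            (fun t => SpaceTime.restrictL2 (S := K ∩ Ω) inter_subset_right
              (v t - M.proj k v t)) ≤
          C * ENNReal.ofReal (M.h n ^ (s - m)) *
            SpaceTime.derivNorm s (M.patch n)
              (fun t => SpaceTime.restrictL2 (S := K ∩ Ω) inter_subset_right (v t))) := by
  obtain ⟨C, hC⟩ := SpaceTime.exists_derivNorm_sub_proj_le k hk κ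
  refine ⟨C, fun T _ M hM d _ Ω _ hΩ v hv m s hms hs n hn => ?_⟩
  have hvi := SpaceTime.integrableOn_of_mem_V hv
  refine ⟨fun ω _ hω => ?_, fun S _ K _ => ?_⟩
  · have h := hC T M hM _ (fun t => SpaceTime.toWnegCLM (hΩ.subset hω) hω (v t))
      ((SpaceTime.toWnegCLM (hΩ.subset hω) hω).integrable_comp hvi) m s hms hs n hn
    simp only [← M.map_proj k _ hvi, ← map_sub] at h
    exact h
  · have h := hC T M hM _ (fun t => SpaceTime.restrictL2CLM (S := K ∩ Ω) inter_subset_right (v t))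
      ((SpaceTime.restrictL2CLM inter_subset_right).integrable_comp hvi) m s hms hs n hn
    simp only [← M.map_proj k _ hvi, ← map_sub] at h
    exact h
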